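/- Let $m \ge 3$ and $1 \le j < m$ be integers with $\gcd(m,j)=1$, let $\lambda>0$ be the unique positive real number with $\lambda^{2m}=\lambda^{2j}+1$ (so $\lambda>1$), and identify the plane with $\mathbb{C}$. Tiles and substitutions. Put $a=\lambda^{-m}$, $b=\sqrt{1-a^2}=\lambda^{j-m}$, $\theta=\arccos a$. Let $T_1$ be the right triangle with vertices $0,\,-a,\,-a+ib$, and let $T_{i+1}=\lambda^{i}T_1$ for $1\le i\le m-1$. A tile is a congruent copy $g(T_i)$ of one of these prototiles, where $g(z)=e^{i\alpha}z+t$ or $g(z)=e^{i\alpha}\bar z+t$; its angle is $\alpha(g(T_i))=\alpha\in[0,2\pi)$. A substitution $\sigma$ with factor $c$ assigns to each prototile $T_i$ a set $\sigma(T_i)$ of tiles filling $cT_i$; it is extended to sets of tiles by $\sigma(g(T_i))=g_c(\sigma(T_i))$, where $g_c(z)=c\,g(z/c)$. The Pythagoras substitution $\sigma_{m,j}$ has factor $\lambda$ and is given by $\sigma_{m,j}(T_i)=\{T_{i+1}\}$ for $i<m$ and $\sigma_{m,j}(T_m)=\{\varphi(T_1),\psi(T_{j+1})\}$, with $\varphi(z)=e^{-i\theta}\bar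 z$ and $\psi(z)=e^{-i(\theta+\pi/2)}\bar z-1$ (the dissection of $\lambda T_m$ by the altitude on its hypotenuse). The patch $\sigma_{m,j}^{2m}(T_1)$ contains two tiles of type $T_{j+1}$ that form the rectangle with vertices $-\lambda^m,\,-a,\,-a+ib,\,-\lambda^m+ib$ and are separated by its diagonal from $-\lambda^m$ to $-a+ib$. The Pythia substitution $\rho=\rho_{m,j}$, with factor $\lambda^{2m}$, is defined as follows: $\rho(T_1)$ is $\sigma_{m,j}^{2m}(T_1)$ with these two tiles replaced by the two tiles of type $T_{j+1}$ into which the other diagonal dissects the rectangle, and $\rho(T_i)=\sigma_{m,j}^{\,i-1}(\rho(T_1))$ for $2\le i\le m$. A substitution tiling for $\rho$ is a set $\mathcal T$ of tiles that covers the plane, whose tiles have pairwise disjoint interiors, and each of whose finite subsets is congruent to a subset of $\rho^k(T_i)$ for some $k,i$. A supertile is a set of tiles congruent to $\rho^k(T_i)$ for some $k,i$. Theorem. Every substitution tiling $\mathcal T$ for $\rho_{m,j}$ has statistical circular symmetry. That is, $\rho_{m,j}$ is primitive (some power of the matrix whose entry $(i,k)$ is the number of tiles of type $T_k$ in $\rho(T_i)$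 has only positive entries), and for all $0\le x<y<2\pi$: 1. if $t_1,t_2,\dots$ is an enumeration of $\mathcal T$ without repetition such that $\{t_1,\dots,t_\ell\}$ is a supertile for infinitely many $\ell$, then $\frac1\ell\,\#\{k\le \ell : \alpha(t_k)\in[x,y]\}\to\frac{y-x}{2\pi}$ as $\ell\to\infty$ through these $\ell$; 2. with $\mathcal T_r$ the set of tiles of $\mathcal T$ that meet the closed ball of radius $r$ about the origin, $\#\{t\in\mathcal T_r : \alpha(t)\in[x,y]\}\,/\,\#\mathcal T_r\to\frac{y-x}{2\pi}$ as $r\to\infty$. -/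

import Mathlib

open Set Filter Topology

noncomputable section

namespace SubstTiling

/-- Congruences of the plane, which is identified with `ℂ`; reflections are allowed. -/
abbrev Motion : Type := ℂ ≃ᵃⁱ[ℝ] ℂ

/-- The motion `z ↦ exp (i φ) * z + t`. -/
def rot (φ : ℝ) (t : ℂ) : Motion :=
  (rotation (Circle.exp φ)).toAffineIsometryEquiv.trans (AffineIsometryEquiv.constVAdd ℝ ℂ t)

/-- The motion `z ↦ exp (i φ) * conj z + t`. -/
def mirror (φ : ℝ) (t : ℂ) : Motion :=
  (Complex.conjLIE.trans (rotation (Circle.exp φ))).toAffineIsometryEquiv.trans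
    (AffineIsometryEquiv.constVAdd ℝ ℂ t)

/-- The motion with the same linear part as `g` and with translation part scaled by `c`;
this is `z ↦ c * g (z / c)` if `c ≠ 0`. -/
def dilate (c : ℝ) (g : Motion) : Motion :=
  g.linearIsometryEquiv.toAffineIsometryEquiv.trans
    (AffineIsometryEquiv.constVAdd ℝ ℂ (c • g 0))

theorem rot_apply (φ : ℝ) (t z : ℂ) : rot φ t z = Complex.exp (φ * Complex.I) * z + t := by
  simp [rot, add_comm]

theorem mirror_apply (φ : ℝ) (t z : ℂ) :
    mirror φ t z = Complex.exp (φ * Complex.I) * (starRingEnd ℂ) z + t := by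
  simp [mirror, add_comm]

theorem dilate_apply (c : ℝ) (g : Motion) (z : ℂ) :
    dilate c g z = g.linearIsometryEquiv z + c * g 0 := by
  simp [dilate, add_comm]

/-- A tile is a congruent copy of a prototile: the pair `(i, g)` stands for the image of the
prototile with index `i` under the motion `g`. -/
abbrev Tile (n : ℕ) : Type := Fin n × Motion

/-- The copy of a tile under a motion. -/
def Tile.move {n : ℕ} (g : Motion) (T : Tile n) : Tile n := (T.1, g * T.2)

/-- The angle `α(T) ∈ [0, 2π)` of a tile: `α` for the tile `z ↦ exp (i α) * z + t` applied to a
prototile, and for the tile `z ↦ exp (i α) * conj z + t` applied to a prototile. In both cases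
`exp (i α)` is the image of `1` under the linear part. -/
def Tile.angle {n : ℕ} (T : Tile n) : ℝ :=
  toIcoMod Real.two_pi_pos 0 (Complex.arg (T.2.linearIsometryEquiv 1))

/-- A tile substitution with `n` prototiles `proto i`: the prototile with index `i` is enlarged
by `factor` and replaced by the tiles in `rule i`. -/
structure Substitution (n : ℕ) where
  /-- the substitution factor -/
  factor : ℝ
  /-- the prototiles -/
  proto : Fin n → Set ℂ
  /-- the tiles that replace an enlarged prototile -/
  rule : Fin n → Set (Tile n)

namespace Substitution

variable {n : ℕ} (s : Substitution n)

/-- The subset of the plane that a tile occupies. -/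
def support (T : Tile n) : Set ℂ := T.2 '' s.proto T.1

/-- The substitution acting on a collection of tiles. -/
def apply (P : Set (Tile n)) : Set (Tile n) :=
  ⋃ T ∈ P, Tile.move (dilate s.factor T.2) '' s.rule T.1

/-- The supertile of order `k` of the prototile with index `i`, that is, the `k`-fold iterate
of the substitution on this prototile. -/
def supertile (k : ℕ) (i : Fin n) : Set (Tile n) := s.apply^[k] {(i, 1)}

/-- The substitution matrix: the entry `(i, k)` is the number of tiles of type `k` that replace
the prototile with index `i`. -/
def matrix : Matrix (Fin n) (Fin n) ℝ :=
  Matrix.of fun i k => (({g : Motion | (k, g) ∈ s.rule i}).ncard : ℝ)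

/-- A tiling of the plane: a covering that is also a packing. -/
structure IsTiling (𝒯 : Set (Tile n)) : Prop where
  covers : ⋃ T ∈ 𝒯, s.support T = univ
  packs : 𝒯.Pairwise fun T T' => Disjoint (interior (s.support T)) (interior (s.support T'))

/-- A substitution tiling: a tiling each of whose patches (finite sets of its tiles) is
congruent to a patch in some supertile of a prototile. -/
structure IsSubstitutionTiling (𝒯 : Set (Tile n)) : Prop where
  isTiling : s.IsTiling 𝒯
  patch : ∀ P ⊆ 𝒯, P.Finite →
    ∃ (k : ℕ) (i : Fin n) (g : Motion), Tile.move g '' P ⊆ s.supertile k i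

/-- The set of tiles `P` is congruent to a supertile of a prototile. -/
def IsSupertile (P : Set (Tile n)) : Prop :=
  ∃ (k : ℕ) (i : Fin n) (g : Motion), P = Tile.move g '' s.supertile k i

/-- Statistical circular symmetry of a tiling `𝒯` by tiles of a primitive substitution.

`of_supertiles`: if the tiles of `𝒯` are arranged in a sequence such that arbitrarily long
initial segments are supertiles, then the angles are uniformly distributed in `[0, 2π)` along
these initial segments.

`of_balls`: the angles are uniformly distributed in `[0, 2π)` with respect to the arrangement
of the tiles by distance from the origin, that is, along the sets of all tiles that meet the
closed ball of radius `r` about the origin, as `r → ∞`. -/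
structure HasStatisticalCircularSymmetry (𝒯 : Set (Tile n)) : Prop where
  primitive : s.matrix.IsPrimitive
  of_supertiles : ∀ e : ℕ → Tile n, Function.Injective e → range e = 𝒯 →
    (∀ N : ℕ, ∃ l ≥ N, s.IsSupertile (e '' Iio l)) →
    ∀ x y : ℝ, 0 ≤ x → x < y → y < 2 * Real.pi →
      Tendsto
        (fun l : ℕ => (1 / (l : ℝ)) *
          ∑ k ∈ Finset.range l, (Icc x y).indicator (fun _ => (1 : ℝ)) (e k).angle)
        (atTop ⊓ 𝓟 {l : ℕ | s.IsSupertile (e '' Iio l)})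
        (𝓝 ((y - x) / (2 * Real.pi)))
  of_balls : ∀ x y : ℝ, 0 ≤ x → x < y → y < 2 * Real.pi →
      Tendsto
        (fun r : ℝ =>
          (({T ∈ 𝒯 | (s.support T ∩ Metric.closedBall 0 r).Nonempty ∧
              T.angle ∈ Icc x y}).ncard : ℝ) /
            (({T ∈ 𝒯 | (s.support T ∩ Metric.closedBall 0 r).Nonempty}).ncard : ℝ))
        atTop
        (𝓝 ((y - x) / (2 * Real.pi)))

end Substitution

/-! The Pythagoras and Pythia substitutions. The prototiles `T_1, …, T_m` have the indices
`0, …, m - 1`. -/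

theorem existsUnique_factor {m j : ℕ} (hjm : j < m) :
    ∃! x : ℝ, 0 < x ∧ x ^ (2 * m) = x ^ (2 * j) + 1 := by
  obtain ⟨d, rfl⟩ := Nat.exists_eq_add_of_lt hjm
  have key : ∀ x : ℝ, x ^ (2 * (j + d + 1)) = x ^ (2 * j) * x ^ (2 * (d + 1)) := fun x => by
    rw [← pow_add]; congr 1; ring
  have one_lt : ∀ x : ℝ, 0 < x → x ^ (2 * (j + d + 1)) = x ^ (2 * j) + 1 → 1 < x := by
    intro x hx h
    by_contra hle
    have h1 : x ^ (2 * (j + d + 1)) ≤ 1 := pow_le_one₀ hx.le (not_lt.mp hle)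
    have h2 : 0 < x ^ (2 * j) := by positivity
    linarith
  have mono : ∀ x y : ℝ, 1 < x → x < y →
      x ^ (2 * (j + d + 1)) - x ^ (2 * j) < y ^ (2 * (j + d + 1)) - y ^ (2 * j) := by
    intro x y hx hxy
    have h1 : x ^ (2 * j) ≤ y ^ (2 * j) := by gcongr
    have h2 : x ^ (2 * (d + 1)) < y ^ (2 * (d + 1)) := by gcongr
    have h3 : 1 < x ^ (2 * (d + 1)) := one_lt_pow₀ hx (by omega)
    have h4 : 0 < x ^ (2 * j) := by positivity
    rw [key, key]
    nlinarith
  have hc : ContinuousOn (fun x : ℝ => x ^ (2 * (j + d + 1)) - x ^ (2 * j)) (Icc 1 2) := by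
    fun_prop
  have h2 : (1 : ℝ) ≤ 2 ^ (2 * (j + d + 1)) - 2 ^ (2 * j) := by
    have h3 : (1 : ℝ) ≤ 2 ^ (2 * j) := one_le_pow₀ (by norm_num)
    have h4 : (2 : ℝ) ^ 1 ≤ 2 ^ (2 * (d + 1)) := pow_le_pow_right₀ (by norm_num) (by omega)
    rw [key]
    nlinarith
  obtain ⟨x, hx, hfx⟩ := intermediate_value_Icc (by norm_num : (1 : ℝ) ≤ 2) hc
    ⟨by simp, h2⟩
  have hx0 : 0 < x := lt_of_lt_of_le one_pos hx.1
  have hxe : x ^ (2 * (j + d + 1)) = x ^ (2 * j) + 1 := by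
    simp only at hfx; linarith
  refine ⟨x, ⟨hx0, hxe⟩, ?_⟩
  rintro y ⟨hy0, hye⟩
  have hx1 := one_lt x hx0 hxe
  have hy1 := one_lt y hy0 hye
  rcases lt_trichotomy y x with h | h | h
  · have := mono y x hy1 h; linarith
  · exact h
  · have := mono x y hx1 h; linarith

/-- The factor of the Pythagoras substitution: the positive real number `x` with
`x ^ (2 * m) = x ^ (2 * j) + 1`. -/
def pythagorasFactor {m j : ℕ} (hjm : j < m) : ℝ := (existsUnique_factor hjm).choose

/-- The length `a = lam ^ (-m)` of the short leg of the first prototile. -/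
def shortLeg {m j : ℕ} (hjm : j < m) : ℝ := (pythagorasFactor hjm ^ m)⁻¹

/-- The length `√(1 - a ^ 2)` of the long leg of the first prototile. -/
def longLeg {m j : ℕ} (hjm : j < m) : ℝ := √(1 - shortLeg hjm ^ 2)

/-- The angle between the short leg and the hypotenuse of the prototiles. -/
def theta {m j : ℕ} (hjm : j < m) : ℝ := Real.arccos (shortLeg hjm)

/-- The vertex `-a + i √(1 - a ^ 2)` of the first prototile. -/
def apex {m j : ℕ} (hjm : j < m) : ℂ := -(shortLeg hjm : ℂ) + (longLeg hjm : ℂ) * Complex.I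

/-- The prototiles: the first one is the right triangle with vertices `0`, `-a` and
`-a + i √(1 - a ^ 2)`, and the others are its multiples by powers of the factor. -/
def triangle {m j : ℕ} (hjm : j < m) (i : Fin m) : Set ℂ :=
  (fun z : ℂ => (pythagorasFactor hjm : ℂ) ^ (i : ℕ) * z) ''
    convexHull ℝ {0, -(shortLeg hjm : ℂ), apex hjm}

/-- The Pythagoras substitution. The last prototile, enlarged by `lam`, is the triangle with
vertices `0`, `-1` (right angle) and `-1 + i lam ^ j`; its altitude on the hypotenuse dissects
it into a copy of `T_1` (with vertices `0`, `a * apex`, `-1`) and a copy of `T_{j+1}`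
(with vertices `-1`, `a * apex`, `-1 + i lam ^ j`), both of them mirror images. -/
def pythagoras {m j : ℕ} (hjm : j < m) : Substitution m where
  factor := pythagorasFactor hjm
  proto := triangle hjm
  rule i :=
    if h : (i : ℕ) + 1 < m then {(⟨i + 1, h⟩, 1)}
    else {(⟨0, by omega⟩, mirror (-theta hjm) 0),
      (⟨j, hjm⟩, mirror (-theta hjm - Real.pi / 2) (-1))}

/-- The two tiles `T_{j+1}` in the `2m`-fold Pythagoras iterate of `T_1` which form a rectangle
and whose common side is the altitude on the hypotenuse of the large triangle. The rectangle has
the vertices `C = -lam ^ m`, `P = -a`, `H = apex`, `Q = -lam ^ m + i √(1 - a ^ 2)`, where `C` is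
the right-angled vertex of the large triangle and `H` the foot of its altitude; the tiles are
`H P C` and `C Q H`, listed as the images of the vertices of the prototile. -/
def oldPair {m j : ℕ} (hjm : j < m) : Set (Tile m) :=
  {(⟨j, hjm⟩, rot (Real.pi / 2) (apex hjm)),
    (⟨j, hjm⟩, rot (-(Real.pi / 2)) (-(pythagorasFactor hjm : ℂ) ^ m))}

/-- The two tiles `Q C P` and `P H Q` of type `T_{j+1}` that arise by dissecting the same
rectangle along its other diagonal. -/
def newPair {m j : ℕ} (hjm : j < m) : Set (Tile m) :=
  {(⟨j, hjm⟩, mirror (Real.pi / 2)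
      (-(pythagorasFactor hjm : ℂ) ^ m + (longLeg hjm : ℂ) * Complex.I)),
    (⟨j, hjm⟩, mirror (-(Real.pi / 2)) (-(shortLeg hjm : ℂ)))}

/-- The Pythia substitution: `T_1` is replaced by the `2m`-fold Pythagoras iterate of `T_1` with
the diagonal of the rectangle switched, and `T_{i+1}` by the `i`-fold Pythagoras iterate of this
patch. -/
def pythia {m j : ℕ} (hjm : j < m) : Substitution m where
  factor := pythagorasFactor hjm ^ (2 * m)
  proto := triangle hjm
  rule i := (pythagoras hjm).apply^[i]
    (((pythagoras hjm).supertile (2 * m) ⟨0, by omega⟩ \ oldPair hjm) ∪ newPair hjm)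

end SubstTiling

end

/-!
By Weyl's criterion it suffices that, for every `p > 0`, the sum of `exp (i p α(T))` over the tiles
`T` of a supertile is small compared with the number of these tiles. The areas of the prototiles
form a positive eigenvector of the substitution matrix, which bounds these sums. If every `l`-fold
supertile contains two tiles of the same type whose linear parts differ by a rotation `u` with
`u ^ p ≠ 1`, then the sums over their descendants differ by the factor `u ^ p`, and the resulting
cancellation improves the bound by a fixed factor in every `l` steps. The tiles near the origin are
a union of supertiles of a fixed order up to `O(r)` tiles along the boundary of the ball, while
their number grows like `r ^ 2`.

For the Pythia substitution, switching the diagonal produces two tiles of the same type that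
differ by the rotation `-exp (2 i θ)`. It has infinite order: `a = cos θ` is a nonzero algebraic
integer, and if `exp (i θ)` were a root of unity, all conjugates of `a` would have absolute value at
most `1`, so `a` would be a root of unity by Kronecker's theorem; but `0 < a < 1`. Primitivity holds
because the tiles of `ρ(T_i)` include ones of the types `i` and `i + j` modulo `m`, and `j`
generates the integers modulo `m`.
-/

noncomputable section

namespace SubstTiling

/-! ### Motions -/

theorem motion_apply (g : Motion) (z : ℂ) : g z = g.linearIsometryEquiv z + g 0 := by
  simpa using g.map_vadd 0 z

theorem motion_ext {g h : Motion} (hlin : ∀ z, g.linearIsometryEquiv z = h.linearIsometryEquiv z)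
    (h0 : g 0 = h 0) : g = h := by
  ext z
  rw [motion_apply, motion_apply h, hlin, h0]

theorem linear_rot (φ : ℝ) (t z : ℂ) :
    (rot φ t).linearIsometryEquiv z = Complex.exp (φ * Complex.I) * z := by
  simpa [rot_apply, eq_comm] using motion_apply (rot φ t) z

theorem linear_mirror (φ : ℝ) (t z : ℂ) :
    (mirror φ t).linearIsometryEquiv z = Complex.exp (φ * Complex.I) * (starRingEnd ℂ) z := by
  simpa [mirror_apply, eq_comm] using motion_apply (mirror φ t) z

theorem dilate_apply_zero (c : ℝ) (g : Motion) : dilate c g 0 = c * g 0 := by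
  simp [dilate_apply]

theorem dilate_mul (c : ℝ) (g h : Motion) : dilate c (g * h) = dilate c g * dilate c h := by
  refine motion_ext (fun z => rfl) ?_
  have hsmul := map_smul g.linearIsometryEquiv c (h 0)
  simp only [Complex.real_smul] at hsmul
  simp only [AffineIsometryEquiv.coe_mul, Function.comp_apply, dilate_apply_zero, dilate_apply c g,
    motion_apply g (h 0), mul_add, hsmul]

theorem dilate_dilate (c d : ℝ) (g : Motion) : dilate c (dilate d g) = dilate (c * d) g :=
  motion_ext (fun _ => rfl) (by simp [dilate_apply_zero, mul_assoc])

theorem dilate_one_left (g : Motion) : dilate 1 g = g :=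
  motion_ext (fun _ => rfl) (by simp [dilate_apply_zero])

theorem dilate_one_right (c : ℝ) : dilate c 1 = 1 :=
  motion_ext (fun _ => rfl) (by simp [dilate_apply_zero])

theorem dilate_mirror (c φ : ℝ) (t : ℂ) : dilate c (mirror φ t) = mirror φ (c * t) := by
  refine motion_ext (fun z => ?_) (by simp [dilate_apply_zero, mirror_apply])
  change (mirror φ t).linearIsometryEquiv z = _
  rw [linear_mirror, linear_mirror]

theorem mirror_mul_mirror (φ φ' : ℝ) (t t' : ℂ) :
    mirror φ t * mirror φ' t' =
      rot (φ - φ') (Complex.exp (φ * Complex.I) * (starRingEnd ℂ) t' + t) := by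
  ext z
  simp only [AffineIsometryEquiv.coe_mul, Function.comp_apply, mirror_apply, rot_apply, map_add,
    map_mul, Complex.conj_conj, ← Complex.exp_conj, Complex.conj_ofReal, Complex.conj_I,
    Complex.ofReal_sub, sub_mul, Complex.exp_sub, mul_neg, Complex.exp_neg]
  ring

theorem rot_zero_zero : rot 0 0 = 1 := by
  ext z
  simp [rot_apply]

open scoped Pointwise in
theorem dilate_image_smul (c : ℝ) (g : Motion) (X : Set ℂ) :
    dilate c g '' (c • X) = c • (g '' X) := by
  simp only [← image_smul, image_image]
  refine image_congr fun z _ => ?_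
  rw [dilate_apply, motion_apply g z, smul_add, map_smul, Complex.real_smul, Complex.real_smul]

theorem interior_image_motion (g : Motion) (X : Set ℂ) :
    interior (g '' X) = g '' interior X :=
  (g.toHomeomorph.image_interior X).symm

/-! ### Tiles and iterated substitutions -/

namespace Tile

variable {n : ℕ}

theorem move_one (T : Tile n) : T.move 1 = T := by
  simp [move]

theorem move_mul (g h : Motion) (T : Tile n) : T.move (g * h) = (T.move h).move g := by
  simp [move, mul_assoc]

theorem move_injective (g : Motion) : Function.Injective (move (n := n) g) := by
  rintro ⟨i, a⟩ ⟨k, b⟩ h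
  simpa [move] using h

theorem move_self (T : Tile n) : move T.2 (T.1, 1) = T := by
  simp [move]

end Tile

namespace Substitution

variable {n : ℕ} (s : Substitution n)

theorem support_move (g : Motion) (T : Tile n) : s.support (T.move g) = g '' s.support T := by
  simp [support, Tile.move, image_image]

theorem apply_iUnion {ι : Sort*} (P : ι → Set (Tile n)) :
    s.apply (⋃ i, P i) = ⋃ i, s.apply (P i) := by
  simp only [apply, biUnion_iUnion]

theorem apply_singleton (T : Tile n) :
    s.apply {T} = Tile.move (dilate s.factor T.2) '' s.rule T.1 := by
  simp [apply]

theorem apply_move (g : Motion) (P : Set (Tile n)) :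
    s.apply (Tile.move g '' P) = Tile.move (dilate s.factor g) '' s.apply P := by
  simp only [apply, image_iUnion, biUnion_image, image_image, ← Tile.move_mul, ← dilate_mul]
  rfl

theorem iterate_apply_iUnion (k : ℕ) {ι : Sort*} (P : ι → Set (Tile n)) :
    s.apply^[k] (⋃ i, P i) = ⋃ i, s.apply^[k] (P i) := by
  induction k with
  | zero => simp
  | succ k ih => simp only [Function.iterate_succ_apply', ih, apply_iUnion]

theorem iterate_apply_eq_biUnion (k : ℕ) (P : Set (Tile n)) :
    s.apply^[k] P = ⋃ T ∈ P, s.apply^[k] {T} := by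
  simp only [← iterate_apply_iUnion, biUnion_of_singleton]

theorem iterate_apply_union (k : ℕ) (P Q : Set (Tile n)) :
    s.apply^[k] (P ∪ Q) = s.apply^[k] P ∪ s.apply^[k] Q := by
  simp only [union_eq_iUnion, iterate_apply_iUnion, Bool.apply_cond]

theorem iterate_apply_mono (k : ℕ) {P Q : Set (Tile n)} (h : P ⊆ Q) :
    s.apply^[k] P ⊆ s.apply^[k] Q := by
  rw [← union_eq_right, ← iterate_apply_union, union_eq_right.2 h]

theorem iterate_apply_move (k : ℕ) (g : Motion) (P : Set (Tile n)) :
    s.apply^[k] (Tile.move g '' P) = Tile.move (dilate (s.factor ^ k) g) '' s.apply^[k] P := by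
  induction k with
  | zero => simp [dilate_one_left]
  | succ k ih =>
    simp only [Function.iterate_succ_apply', ih, apply_move, dilate_dilate, pow_succ']

theorem iterate_apply_singleton (k : ℕ) (T : Tile n) :
    s.apply^[k] {T} = Tile.move (dilate (s.factor ^ k) T.2) '' s.supertile k T.1 := by
  rw [supertile, ← iterate_apply_move, image_singleton, Tile.move_self]

theorem move_mem_iterate_apply {k : ℕ} {P : Set (Tile n)} {T T' : Tile n} (hT : T ∈ P)
    (hT' : T' ∈ s.supertile k T.1) :
    T'.move (dilate (s.factor ^ k) T.2) ∈ s.apply^[k] P := by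
  refine s.iterate_apply_mono k (singleton_subset_iff.2 hT) ?_
  rw [iterate_apply_singleton]
  exact mem_image_of_mem _ hT'

theorem supertile_one (i : Fin n) : s.supertile 1 i = s.rule i := by
  simp [supertile, apply_singleton, dilate_one_right, Tile.move_one]

theorem supertile_add (k l : ℕ) (i : Fin n) :
    s.supertile (k + l) i = s.apply^[k] (s.supertile l i) :=
  Function.iterate_add_apply _ _ _ _

theorem move_mem_supertile_add {k l : ℕ} {i : Fin n} {T T' : Tile n}
    (hT : T ∈ s.supertile l i) (hT' : T' ∈ s.supertile k T.1) :
    T'.move (dilate (s.factor ^ k) T.2) ∈ s.supertile (k + l) i :=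
  s.supertile_add k l i ▸ s.move_mem_iterate_apply hT hT'

end Substitution

/-! ### Packings -/

namespace Substitution

open scoped Pointwise

variable {n : ℕ} (s : Substitution n)

/-- The tiles in `P` have pairwise disjoint interiors. -/
def Packs (P : Set (Tile n)) : Prop :=
  P.Pairwise fun T₁ T₂ => Disjoint (interior (s.support T₁)) (interior (s.support T₂))

/-- The substitutions for which supertiles are finite packings by convex bodies: the rule packs
finitely many tiles into each enlarged prototile, but need not fill it. -/
structure IsPacking : Prop where
  factor_pos : 0 < s.factor
  convex : ∀ i, Convex ℝ (s.proto i)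
  compact : ∀ i, IsCompact (s.proto i)
  interior_nonempty : ∀ i, (interior (s.proto i)).Nonempty
  rule_finite : ∀ i, (s.rule i).Finite
  rule_packs : ∀ i, s.Packs (s.rule i)
  rule_subset : ∀ i, ∀ T ∈ s.rule i, s.support T ⊆ s.factor • s.proto i

variable {s}

theorem Packs.mono {P Q : Set (Tile n)} (hQ : s.Packs Q) (h : P ⊆ Q) : s.Packs P :=
  Set.Pairwise.mono h hQ

theorem disjoint_interior_support_move {g : Motion} {T T' : Tile n} :
    Disjoint (interior (s.support (T.move g))) (interior (s.support (T'.move g))) ↔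
      Disjoint (interior (s.support T)) (interior (s.support T')) := by
  simp only [support_move, interior_image_motion, disjoint_image_iff g.injective]

theorem Packs.move {P : Set (Tile n)} (hP : s.Packs P) (g : Motion) :
    s.Packs (Tile.move g '' P) := by
  rintro _ ⟨T, hT, rfl⟩ _ ⟨T', hT', rfl⟩ hne
  exact disjoint_interior_support_move.2 (hP hT hT' fun h => hne (h ▸ rfl))

theorem packs_singleton (T : Tile n) : s.Packs {T} := pairwise_singleton _ _

namespace IsPacking

theorem support_interior_nonempty (hs : s.IsPacking) (T : Tile n) :
    (interior (s.support T)).Nonempty := by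
  rw [support, interior_image_motion]
  exact (hs.interior_nonempty _).image _

theorem support_isCompact (hs : s.IsPacking) (T : Tile n) : IsCompact (s.support T) :=
  (hs.compact _).image T.2.continuous

theorem support_convex (hs : s.IsPacking) (T : Tile n) : Convex ℝ (s.support T) :=
  (hs.convex _).affine_image (T.2.toAffineEquiv : ℂ →ᵃ[ℝ] ℂ)

theorem inter_interior_support_nonempty (hs : s.IsPacking) {T : Tile n} {O : Set ℂ}
    (hO : IsOpen O) (h : (s.support T ∩ O).Nonempty) :
    (O ∩ interior (s.support T)).Nonempty := by
  obtain ⟨z, hz, hzO⟩ := h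
  refine mem_closure_iff.1 ?_ O hO hzO
  rw [(hs.support_convex T).closure_interior_eq_closure_of_nonempty_interior
    (hs.support_interior_nonempty T)]
  exact subset_closure hz

theorem support_subset_of_mem_apply_singleton (hs : s.IsPacking) {T t : Tile n}
    (h : t ∈ s.apply {T}) : s.support t ⊆ s.factor • s.support T := by
  rw [apply_singleton] at h
  obtain ⟨t', ht', rfl⟩ := h
  rw [support_move, show s.support T = T.2 '' s.proto T.1 from rfl, ← dilate_image_smul]
  exact image_mono (hs.rule_subset _ _ ht')

theorem support_subset_of_mem_iterate_singleton (hs : s.IsPacking) {k : ℕ} {T t : Tile n}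
    (h : t ∈ s.apply^[k] {T}) : s.support t ⊆ s.factor ^ k • s.support T := by
  induction k generalizing t with
  | zero => simp [mem_singleton_iff.1 h]
  | succ k ih =>
    rw [Function.iterate_succ_apply', ← biUnion_of_singleton (s.apply^[k] {T})] at h
    simp only [apply_iUnion, mem_iUnion] at h
    obtain ⟨t', ht', ht⟩ := h
    rw [pow_succ', mul_smul]
    exact (hs.support_subset_of_mem_apply_singleton ht).trans (smul_set_mono (ih ht'))

theorem disjoint_interior_of_mem_iterate_singleton (hs : s.IsPacking) {k : ℕ} {T T' t t' : Tile n}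
    (h : Disjoint (interior (s.support T)) (interior (s.support T')))
    (ht : t ∈ s.apply^[k] {T}) (ht' : t' ∈ s.apply^[k] {T'}) :
    Disjoint (interior (s.support t)) (interior (s.support t')) := by
  have hk : s.factor ^ k ≠ 0 := (pow_pos hs.factor_pos k).ne'
  refine Disjoint.mono (interior_mono (hs.support_subset_of_mem_iterate_singleton ht))
    (interior_mono (hs.support_subset_of_mem_iterate_singleton ht')) ?_
  rw [interior_smul₀ hk, interior_smul₀ hk]
  exact (disjoint_image_iff (smul_right_injective ℂ hk)).2 h

theorem disjoint_iterate_singleton (hs : s.IsPacking) (k : ℕ) {T T' : Tile n}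
    (h : Disjoint (interior (s.support T)) (interior (s.support T'))) :
    Disjoint (s.apply^[k] {T}) (s.apply^[k] {T'}) := by
  refine Set.disjoint_left.2 fun t ht ht' => ?_
  have := hs.disjoint_interior_of_mem_iterate_singleton h ht ht'
  exact (hs.support_interior_nonempty t).ne_empty (disjoint_self.1 this)

theorem packs_apply (hs : s.IsPacking) {P : Set (Tile n)} (hP : s.Packs P) :
    s.Packs (s.apply P) := by
  intro t ht t' ht' hne
  simp only [apply, mem_iUnion] at ht ht'
  obtain ⟨T, hT, h⟩ := ht
  obtain ⟨T', hT', h'⟩ := ht'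
  by_cases hTT : T = T'
  · subst hTT
    exact (hs.rule_packs T.1).move _ h h' hne
  · rw [← apply_singleton] at h h'
    exact hs.disjoint_interior_of_mem_iterate_singleton (k := 1) (hP hT hT' hTT) h h'

theorem packs_iterate (hs : s.IsPacking) {P : Set (Tile n)} (hP : s.Packs P) (k : ℕ) :
    s.Packs (s.apply^[k] P) :=
  Function.Iterate.rec (fun P => s.Packs P) hP (fun _ => hs.packs_apply) k

theorem packs_supertile (hs : s.IsPacking) (k : ℕ) (i : Fin n) : s.Packs (s.supertile k i) :=
  hs.packs_iterate (packs_singleton _) k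

theorem finite_iterate (hs : s.IsPacking) {P : Set (Tile n)} (hP : P.Finite) (k : ℕ) :
    (s.apply^[k] P).Finite :=
  Function.Iterate.rec (fun P : Set (Tile n) => P.Finite) hP
    (fun _ hP => hP.biUnion fun T _ => (hs.rule_finite T.1).image _) k

theorem finite_supertile (hs : s.IsPacking) (k : ℕ) (i : Fin n) : (s.supertile k i).Finite :=
  hs.finite_iterate (finite_singleton _) k

theorem finsum_iterate (hs : s.IsPacking) {M : Type*} [AddCommMonoid M] {P : Set (Tile n)}
    (hP : s.Packs P) (hfin : P.Finite) (k : ℕ) (f : Tile n → M) :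
    ∑ᶠ t ∈ s.apply^[k] P, f t = ∑ᶠ T ∈ P, ∑ᶠ t ∈ s.apply^[k] {T}, f t := by
  rw [iterate_apply_eq_biUnion]
  exact finsum_mem_biUnion
    (fun T hT T' hT' hne => hs.disjoint_iterate_singleton k (hP hT hT' hne)) hfin
    fun T _ => hs.finite_iterate (finite_singleton T) k

end IsPacking

/-- A positive right eigenvector `v` of the substitution matrix with the eigenvalue `q`, such as
the areas of the prototiles with the square of the factor. -/
structure IsPerronWeight (s : Substitution n) (q : ℝ) (v : Fin n → ℝ) : Prop where
  pos : ∀ i, 0 < v i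
  finsum_rule : ∀ i, ∑ᶠ T ∈ s.rule i, v T.1 = q * v i

theorem IsPerronWeight.finsum_iterate {q : ℝ} {v : Fin n → ℝ} (hv : s.IsPerronWeight q v)
    (hs : s.IsPacking) {P : Set (Tile n)} (hP : s.Packs P) (hfin : P.Finite) (k : ℕ) :
    ∑ᶠ T ∈ s.apply^[k] P, v T.1 = q ^ k * ∑ᶠ T ∈ P, v T.1 := by
  induction k with
  | zero => simp
  | succ k ih =>
    rw [add_comm, Function.iterate_add_apply, hs.finsum_iterate (hs.packs_iterate hP k)
      (hs.finite_iterate hfin k), add_comm, pow_succ' q, mul_assoc, ← ih, mul_finsum_mem]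
    refine finsum_mem_congr rfl fun T _ => ?_
    rw [Function.iterate_one, apply_singleton, finsum_mem_image (Tile.move_injective _).injOn,
      ← hv.finsum_rule]
    rfl

theorem IsPerronWeight.finsum_supertile {q : ℝ} {v : Fin n → ℝ} (hv : s.IsPerronWeight q v)
    (hs : s.IsPacking) (k : ℕ) (i : Fin n) :
    ∑ᶠ T ∈ s.supertile k i, v T.1 = q ^ k * v i := by
  rw [supertile, hv.finsum_iterate hs (packs_singleton _) (finite_singleton _),
    finsum_mem_singleton]

end Substitution

/-! ### Exponential sums over supertiles -/

theorem norm_finsum_mem_le {α E : Type*} [SeminormedAddCommGroup E] {P : Set α} (hP : P.Finite)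
    (f : α → E) : ‖∑ᶠ t ∈ P, f t‖ ≤ ∑ᶠ t ∈ P, ‖f t‖ := by
  simpa only [finsum_mem_eq_finite_toFinset_sum _ hP] using norm_sum_le _ _

theorem finsum_mem_le_finsum_mem {α M : Type*} [AddCommMonoid M] [PartialOrder M]
    [IsOrderedAddMonoid M] {P : Set α} (hP : P.Finite) {f g : α → M} (h : ∀ t ∈ P, f t ≤ g t) :
    ∑ᶠ t ∈ P, f t ≤ ∑ᶠ t ∈ P, g t := by
  simp only [finsum_mem_eq_finite_toFinset_sum _ hP]
  exact Finset.sum_le_sum fun t ht => h t (hP.mem_toFinset.1 ht)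

theorem finsum_mem_const {α M : Type*} [AddCommMonoid M] {P : Set α} (hP : P.Finite) (c : M) :
    ∑ᶠ _t ∈ P, c = P.ncard • c := by
  rw [finsum_mem_eq_finite_toFinset_sum _ hP, Finset.sum_const, ncard_eq_toFinset_card _ hP]

/-- The direction `exp (i α)` of a tile with the angle `α`. -/
def Tile.dir {n : ℕ} (T : Tile n) : ℂ := T.2.linearIsometryEquiv 1

theorem Tile.norm_dir {n : ℕ} (T : Tile n) : ‖T.dir‖ = 1 := by
  simp [dir]

/-- The exponential sum of frequency `p` over the angles of the tiles in `P`. -/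
def weylSum {n : ℕ} (p : ℕ) (P : Set (Tile n)) : ℂ := ∑ᶠ T ∈ P, T.dir ^ p

section WeylSum

variable {n p : ℕ} {P : Set (Tile n)}

theorem norm_weylSum_le (hP : P.Finite) : ‖weylSum p P‖ ≤ P.ncard := by
  refine (norm_finsum_mem_le hP _).trans ?_
  simp [Tile.norm_dir, finsum_mem_const hP]

theorem weylSum_move (g : Motion) :
    weylSum p (Tile.move g '' P) = ∑ᶠ T ∈ P, g.linearIsometryEquiv T.dir ^ p :=
  finsum_mem_image (Tile.move_injective g).injOn

theorem weylSum_move_of_linear_eq_mul {u : ℂ} {g h : Motion}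
    (hu : ∀ z, h.linearIsometryEquiv z = u * g.linearIsometryEquiv z) :
    weylSum p (Tile.move h '' P) = u ^ p * weylSum p (Tile.move g '' P) := by
  simp only [weylSum_move, hu, mul_pow, mul_finsum_mem]

theorem linear_eq_mul_or_mul_conj (g : Motion) : ∃ a : ℂ, ‖a‖ = 1 ∧
    ((∀ z, g.linearIsometryEquiv z = a * z) ∨
      ∀ z, g.linearIsometryEquiv z = a * (starRingEnd ℂ) z) := by
  obtain ⟨a, h | h⟩ := linear_isometry_complex g.linearIsometryEquiv <;>
    exact ⟨a, a.norm_coe, by simp [h]⟩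

theorem norm_weylSum_move (hP : P.Finite) (g : Motion) :
    ‖weylSum p (Tile.move g '' P)‖ = ‖weylSum p P‖ := by
  have hconj := (starRingEnd ℂ).toAddMonoidHom.map_finsum_mem (fun T : Tile n => T.dir ^ p) hP
  simp only [RingHom.toAddMonoidHom_eq_coe, AddMonoidHom.coe_coe, map_pow] at hconj
  obtain ⟨a, ha, h | h⟩ := linear_eq_mul_or_mul_conj g
  · rw [weylSum_move, weylSum]
    simp only [h, mul_pow, ← mul_finsum_mem, norm_mul, norm_pow, ha, one_pow, one_mul]
  · rw [weylSum_move, weylSum]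
    simp only [h, mul_pow, ← mul_finsum_mem, norm_mul, norm_pow, ha, one_pow, one_mul, ← hconj,
      RCLike.norm_conj]

theorem norm_weylSum_iterate_singleton {s : Substitution n} (hs : s.IsPacking) (k : ℕ)
    (T : Tile n) : ‖weylSum p (s.apply^[k] {T})‖ = ‖weylSum p (s.supertile k T.1)‖ := by
  rw [s.iterate_apply_singleton, norm_weylSum_move (hs.finite_supertile k T.1)]

end WeylSum

/-- Two tiles of the same type, one of which arises from the other by turning it through an angle
`β` and a translation, where `exp (i p β) ≠ 1`. The supertiles into which they grow partly cancel
each other in exponential sums of frequency `p`. -/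
structure Interfere {n : ℕ} (p : ℕ) (T T' : Tile n) : Prop where
  type_eq : T'.1 = T.1
  exists_turn : ∃ u : ℂ, u ^ p ≠ 1 ∧
    ∀ z, T'.2.linearIsometryEquiv z = u * T.2.linearIsometryEquiv z

namespace Interfere

variable {n p : ℕ} {T T' : Tile n}

theorem move (h : Interfere p T T') (g : Motion) : Interfere p (T.move g) (T'.move g) := by
  obtain ⟨u, hu, hTT'⟩ := h.exists_turn
  refine ⟨h.type_eq, ?_⟩
  obtain ⟨a, -, hg | hg⟩ := linear_eq_mul_or_mul_conj g
  · refine ⟨u, hu, fun z => ?_⟩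
    change g.linearIsometryEquiv (T'.2.linearIsometryEquiv z) =
      u * g.linearIsometryEquiv (T.2.linearIsometryEquiv z)
    rw [hTT', hg, hg, mul_left_comm]
  · refine ⟨(starRingEnd ℂ) u, fun hu' => hu ((starRingEnd ℂ).injective ?_), fun z => ?_⟩
    · rw [map_pow, hu', map_one]
    · change g.linearIsometryEquiv (T'.2.linearIsometryEquiv z) =
        (starRingEnd ℂ) u * g.linearIsometryEquiv (T.2.linearIsometryEquiv z)
      rw [hTT', hg, hg, map_mul, mul_left_comm]

theorem ne (h : Interfere p T T') : T ≠ T' := by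
  rintro rfl
  obtain ⟨u, hu, hT⟩ := h.exists_turn
  have h1 := hT (T.2.linearIsometryEquiv.symm 1)
  rw [LinearIsometryEquiv.apply_symm_apply, mul_one] at h1
  exact hu (by rw [← h1, one_pow])

theorem exists_norm_weylSum_add_le (h : Interfere p T T') {s : Substitution n}
    (hs : s.IsPacking) : ∃ c < 2, 0 ≤ c ∧ ∀ k,
      ‖weylSum p (s.apply^[k] {T}) + weylSum p (s.apply^[k] {T'})‖ ≤
        c * ‖weylSum p (s.supertile k T.1)‖ := by
  obtain ⟨u, hu, hTT'⟩ := h.exists_turn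
  have hu1 : ‖u ^ p‖ = 1 := by
    have := congrArg norm (hTT' 1)
    rw [norm_mul, LinearIsometryEquiv.norm_map, LinearIsometryEquiv.norm_map, norm_one,
      mul_one] at this
    rw [norm_pow, ← this, one_pow]
  refine ⟨‖1 + u ^ p‖, ?_, norm_nonneg _, fun k => le_of_eq ?_⟩
  · have := norm_add_lt_of_not_sameRay
      (mt (sameRay_iff_of_norm_eq (norm_one.trans hu1.symm)).1 hu.symm)
    rwa [norm_one, hu1, one_add_one_eq_two] at this
  · have hT' : weylSum p (s.apply^[k] {T'}) = u ^ p * weylSum p (s.apply^[k] {T}) := by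
      rw [s.iterate_apply_singleton, s.iterate_apply_singleton, h.type_eq]
      exact weylSum_move_of_linear_eq_mul hTT'
    rw [hT', ← one_add_mul, norm_mul, norm_weylSum_iterate_singleton hs]

end Interfere

namespace Substitution

variable {n p : ℕ} {s : Substitution n} {v : Fin n → ℝ} {q : ℝ}

theorem IsPacking.weylSum_iterate (hs : s.IsPacking) {P : Set (Tile n)} (hP : s.Packs P)
    (hfin : P.Finite) (k : ℕ) :
    weylSum p (s.apply^[k] P) = ∑ᶠ T ∈ P, weylSum p (s.apply^[k] {T}) :=
  hs.finsum_iterate hP hfin k fun t => t.dir ^ p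

namespace IsPerronWeight

theorem norm_weylSum_supertile_add_le (hv : s.IsPerronWeight q v) (hs : s.IsPacking) {k l : ℕ}
    {i : Fin n} {T T' : Tile n} (hT : T ∈ s.supertile l i) (hT' : T' ∈ s.supertile l i)
    (h : Interfere p T T') {c C : ℝ} (hc0 : 0 ≤ c)
    (hc : ‖weylSum p (s.apply^[k] {T}) + weylSum p (s.apply^[k] {T'})‖ ≤
      c * ‖weylSum p (s.supertile k T.1)‖)
    (hC : ∀ i, ‖weylSum p (s.supertile k i)‖ ≤ C * v i) :
    ‖weylSum p (s.supertile (k + l) i)‖ ≤ C * (q ^ l * v i - (2 - c) * v T.1) := by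
  have hfin := hs.finite_supertile l i
  have hpair : ({T, T'} : Set (Tile n)) ⊆ s.supertile l i := pair_subset hT hT'
  have hweight := finsum_mem_add_sdiff (f := fun U => v U.1) hpair hfin
  rw [hv.finsum_supertile hs, finsum_mem_pair h.ne, h.type_eq] at hweight
  have hrest : ‖∑ᶠ U ∈ s.supertile l i \ {T, T'}, weylSum p (s.apply^[k] {U})‖ ≤
      C * ∑ᶠ U ∈ s.supertile l i \ {T, T'}, v U.1 := by
    refine (norm_finsum_mem_le hfin.sdiff _).trans ?_
    rw [mul_finsum_mem]
    refine finsum_mem_le_finsum_mem hfin.sdiff fun U _ => ?_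
    rw [norm_weylSum_iterate_singleton hs]
    exact hC U.1
  rw [supertile_add, hs.weylSum_iterate (hs.packs_supertile l i) hfin,
    ← finsum_mem_add_sdiff hpair hfin, finsum_mem_pair h.ne]
  calc _ ≤ _ := norm_add_le _ _
    _ ≤ c * (C * v T.1) + C * ∑ᶠ U ∈ s.supertile l i \ {T, T'}, v U.1 :=
      add_le_add (hc.trans (mul_le_mul_of_nonneg_left (hC T.1) hc0)) hrest
    _ = C * (q ^ l * v i - (2 - c) * v T.1) := by rw [← hweight]; ring

theorem exists_norm_weylSum_supertile_add_le (hv : s.IsPerronWeight q v) (hs : s.IsPacking)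
    (hq : 0 < q) {l : ℕ} {i : Fin n} {T T' : Tile n} (hT : T ∈ s.supertile l i)
    (hT' : T' ∈ s.supertile l i) (h : Interfere p T T') :
    ∃ r < 1, ∀ k C, (∀ i, ‖weylSum p (s.supertile k i)‖ ≤ C * v i) →
      ‖weylSum p (s.supertile (k + l) i)‖ ≤ r * C * q ^ l * v i := by
  obtain ⟨c, hc2, hc0, hc⟩ := h.exists_norm_weylSum_add_le hs
  have hvi : 0 < q ^ l * v i := mul_pos (pow_pos hq l) (hv.pos i)
  refine ⟨1 - (2 - c) * v T.1 / (q ^ l * v i),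
    sub_lt_self 1 (div_pos (mul_pos (sub_pos.2 hc2) (hv.pos _)) hvi), fun k C hC => ?_⟩
  refine (hv.norm_weylSum_supertile_add_le hs hT hT' h hc0 (hc k) hC).trans_eq ?_
  have := (hv.pos i).ne'
  field_simp

theorem exists_norm_weylSum_le (hv : s.IsPerronWeight q v) (hs : s.IsPacking) (hq : 0 < q)
    {l : ℕ} (hl : ∀ i, ∃ T ∈ s.supertile l i, ∃ T' ∈ s.supertile l i, Interfere p T T') :
    ∃ r ∈ Ioo (0 : ℝ) 1, ∃ C, ∀ a b i,
      ‖weylSum p (s.supertile (b + l * a) i)‖ ≤ r ^ a * C * q ^ (b + l * a) * v i := by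
  choose T hT T' hT' h using hl
  choose r hr hcontract using fun i =>
    hv.exists_norm_weylSum_supertile_add_le hs hq (hT i) (hT' i) (h i)
  obtain ⟨R, hR, hR0⟩ := ((eventually_all.2 fun i => Ioo_mem_nhdsLT (hr i)).and
    (Ioo_mem_nhdsLT (zero_lt_one' ℝ))).exists
  obtain ⟨C, hC⟩ := (finite_range fun i => (v i)⁻¹).bddAbove
  have hCv : ∀ i, 1 ≤ C * v i := fun i => by
    have := mul_le_mul_of_nonneg_right (hC (mem_range_self i)) (hv.pos i).le
    rwa [inv_mul_cancel₀ (hv.pos i).ne'] at this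
  refine ⟨R, hR0, C, fun a => ?_⟩
  induction a with
  | zero =>
    intro b i
    calc ‖weylSum p (s.supertile (b + l * 0) i)‖
        ≤ ∑ᶠ T ∈ s.supertile b i, (1 : ℝ) := by
          simpa [finsum_mem_const (hs.finite_supertile b i)] using
            norm_weylSum_le (hs.finite_supertile b i)
      _ ≤ ∑ᶠ T ∈ s.supertile b i, C * v T.1 :=
          finsum_mem_le_finsum_mem (hs.finite_supertile b i) fun T _ => hCv T.1
      _ = R ^ 0 * C * q ^ (b + l * 0) * v i := by
          rw [← mul_finsum_mem, hv.finsum_supertile hs]; ring_nf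
  | succ a ih =>
    intro b i
    have hnonneg : 0 ≤ R ^ a * C * q ^ (b + l * a) * (q ^ l * v i) := by
      have := mul_nonneg ((norm_nonneg _).trans (ih b i)) (pow_nonneg hq.le l)
      linarith
    rw [mul_add_one, ← add_assoc]
    calc _ ≤ r i * (R ^ a * C * q ^ (b + l * a)) * q ^ l * v i := hcontract i _ _ (ih b)
      _ = r i * (R ^ a * C * q ^ (b + l * a) * (q ^ l * v i)) := by ring
      _ ≤ R * (R ^ a * C * q ^ (b + l * a) * (q ^ l * v i)) :=
        mul_le_mul_of_nonneg_right (hR i).1.le hnonneg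
      _ = _ := by ring

theorem isBigO_ncard_supertile (hv : s.IsPerronWeight q v) (hs : s.IsPacking) (hq : 0 < q)
    (i : Fin n) :
    (fun k => q ^ k * v i) =O[atTop] fun k => ((s.supertile k i).ncard : ℝ) := by
  obtain ⟨B, hB⟩ := (finite_range v).bddAbove
  refine Asymptotics.IsBigO.of_bound B (Eventually.of_forall fun k => ?_)
  rw [Real.norm_of_nonneg (mul_pos (pow_pos hq k) (hv.pos i)).le, Real.norm_natCast,
    ← hv.finsum_supertile hs, mul_comm, ← nsmul_eq_mul,
    ← finsum_mem_const (hs.finite_supertile k i)]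
  exact finsum_mem_le_finsum_mem (hs.finite_supertile k i) fun T _ => hB (mem_range_self T.1)

theorem isLittleO_weylSum_supertile (hv : s.IsPerronWeight q v) (hs : s.IsPacking) (hq : 0 < q)
    {l : ℕ} (hl : ∀ i, ∃ T ∈ s.supertile l i, ∃ T' ∈ s.supertile l i, Interfere p T T')
    (i : Fin n) :
    (fun k => weylSum p (s.supertile k i)) =o[atTop] fun k => ((s.supertile k i).ncard : ℝ) := by
  have hl0 : l ≠ 0 := by
    rintro rfl
    obtain ⟨T, hT, T', hT', h⟩ := hl i
    exact h.ne ((mem_singleton_iff.1 hT).trans (mem_singleton_iff.1 hT').symm)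
  obtain ⟨r, ⟨hr0, hr1⟩, C, hr⟩ := hv.exists_norm_weylSum_le hs hq hl
  have hzero : Tendsto (fun k => r ^ (k / l) * C) atTop (𝓝 0) := by
    simpa using ((tendsto_pow_atTop_nhds_zero_of_lt_one hr0.le hr1).comp
      (Nat.tendsto_div_const_atTop hl0)).mul_const C
  have hbound : ∀ k, ‖weylSum p (s.supertile k i)‖ ≤ r ^ (k / l) * C * (q ^ k * v i) := fun k => by
    simpa only [Nat.mod_add_div, mul_assoc] using hr (k / l) (k % l) i
  refine ((Asymptotics.IsBigO.of_norm_le hbound).trans_isLittleO ?_).trans_isBigO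
    (hv.isBigO_ncard_supertile hs hq i)
  simpa using ((Asymptotics.isLittleO_one_iff ℝ).2 hzero).mul_isBigO
    (Asymptotics.isBigO_refl (fun k => q ^ k * v i) atTop)

end IsPerronWeight

end Substitution

/-! ### Patches around the origin -/

namespace Substitution

open Asymptotics MeasureTheory
open scoped Pointwise

variable {n : ℕ} {s : Substitution n}

theorem volume_image_motion (g : Motion) (A : Set ℂ) : volume (g '' A) = volume A := by
  have hg : g '' A = (· + g 0) '' (g.linearIsometryEquiv '' A) := by
    simp only [image_image, ← motion_apply]
  rw [hg, image_add_right, measure_preimage_add_right, LinearIsometryEquiv.image_eq_preimage_symm]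
  exact g.linearIsometryEquiv.symm.measurePreserving.measure_preimage_equiv
    (f := g.linearIsometryEquiv.symm.toHomeomorph.toMeasurableEquiv) A

namespace IsPacking

theorem exists_ncard_mul_le_volume (hs : s.IsPacking) :
    ∃ c > 0, ∀ P, s.Packs P → ∀ B : Set ℂ, volume B ≠ ⊤ → (∀ T ∈ P, s.support T ⊆ B) →
      P.Finite ∧ P.ncard * c ≤ volume.real B := by
  have hpos : ∀ i, 0 < volume.real (interior (s.proto i)) := fun i =>
    ENNReal.toReal_pos (isOpen_interior.measure_pos volume (hs.interior_nonempty i)).ne'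
      (measure_ne_top_of_subset interior_subset (hs.compact i).measure_lt_top.ne)
  obtain ⟨c, hc, hc0⟩ := ((eventually_all.2 fun i => nhdsWithin_le_nhds
    (gt_mem_nhds (hpos i))).and (self_mem_nhdsWithin : Ioi (0 : ℝ) ∈ 𝓝[>] 0)).exists
  refine ⟨c, hc0, fun P hP B hB hPB => ?_⟩
  have hvol : ∀ T, c ≤ volume.real (interior (s.support T)) := fun T => by
    rw [support, interior_image_motion, measureReal_def, volume_image_motion]
    exact (hc T.1).le
  have hcard : ∀ F : Finset (Tile n), (F : Set (Tile n)) ⊆ P → F.card * c ≤ volume.real B := by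
    intro F hF
    have hFB : ∀ T ∈ F, interior (s.support T) ⊆ B := fun T hT =>
      interior_subset.trans (hPB T (hF hT))
    calc F.card * c ≤ ∑ T ∈ F, volume.real (interior (s.support T)) := by
          simpa using Finset.card_nsmul_le_sum F _ c fun T _ => hvol T
      _ = volume.real (⋃ T ∈ F, interior (s.support T)) :=
          (measureReal_biUnion_finset (hP.mono hF) (fun _ _ => isOpen_interior.measurableSet)
            fun T hT => measure_ne_top_of_subset (hFB T hT) hB).symm
      _ ≤ volume.real B := measureReal_mono (iUnion₂_subset hFB) hB
  have hfin : P.Finite := by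
    by_contra hinf
    obtain ⟨N, hN⟩ := exists_nat_gt (volume.real B / c)
    obtain ⟨F, hF, rfl⟩ := Set.Infinite.exists_subset_card_eq hinf N
    exact ((div_lt_iff₀ hc0).1 hN).not_ge (hcard F hF)
  refine ⟨hfin, ?_⟩
  rw [ncard_eq_toFinset_card _ hfin]
  exact hcard _ hfin.coe_toFinset.subset

theorem exists_dist_le (hs : s.IsPacking) (k : ℕ) :
    ∃ D ≥ 0, ∀ T, ∀ t ∈ s.apply^[k] {T}, ∀ t' ∈ s.apply^[k] {T},
      ∀ z ∈ s.support t, ∀ z' ∈ s.support t', dist z z' ≤ D := by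
  obtain ⟨M, hM⟩ := Finite.exists_le fun i => Metric.diam (s.proto i)
  have hk : 0 < s.factor ^ k := pow_pos hs.factor_pos k
  refine ⟨s.factor ^ k * max M 0, by positivity, fun T t ht t' ht' z hz z' hz' => ?_⟩
  obtain ⟨_, ⟨w, hw, rfl⟩, rfl⟩ := hs.support_subset_of_mem_iterate_singleton ht hz
  obtain ⟨_, ⟨w', hw', rfl⟩, rfl⟩ := hs.support_subset_of_mem_iterate_singleton ht' hz'
  have hdist : dist w w' ≤ max M 0 :=
    (Metric.dist_le_diam_of_mem (hs.compact T.1).isBounded hw hw').trans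
      ((hM T.1).trans (le_max_left _ _))
  dsimp only
  rw [dist_smul₀, AffineIsometryEquiv.dist_map, Real.norm_of_nonneg hk.le]
  gcongr

theorem exists_ncard_le_mul_of_subset_annulus (hs : s.IsPacking) (D : ℝ) (hD : 0 ≤ D) :
    ∃ C, ∀ r ≥ D, ∀ P, s.Packs P →
      (∀ T ∈ P, s.support T ⊆ Metric.closedBall 0 (r + D) \ Metric.ball 0 (r - D)) →
      P.ncard ≤ C * r := by
  obtain ⟨c, hc, hvol⟩ := hs.exists_ncard_mul_le_volume
  refine ⟨4 * D * volume.real (Metric.ball (0 : ℂ) 1) / c, fun r hr P hP hPB => ?_⟩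
  have hball : Metric.ball (0 : ℂ) (r - D) ⊆ Metric.closedBall 0 (r + D) :=
    Metric.ball_subset_closedBall.trans (Metric.closedBall_subset_closedBall (by linarith))
  have h := (hvol P hP _ (measure_ne_top_of_subset sdiff_subset
    measure_closedBall_lt_top.ne) hPB).2
  rw [measureReal_sdiff hball measurableSet_ball measure_closedBall_lt_top.ne,
    ← Measure.addHaar_real_closedBall_eq_addHaar_real_ball,
    Measure.addHaar_real_closedBall _ _ (by linarith),
    Measure.addHaar_real_closedBall _ _ (by linarith), Complex.finrank_real_complex] at h
  rw [div_mul_eq_mul_div, le_div_iff₀ hc]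
  linarith

theorem norm_weylSum_iterate_le (hs : s.IsPacking) {p k : ℕ} {ε : ℝ}
    (hε : ∀ i, ‖weylSum p (s.supertile k i)‖ ≤ ε * (s.supertile k i).ncard) {Q : Set (Tile n)}
    (hQ : s.Packs Q) (hfin : Q.Finite) :
    ‖weylSum p (s.apply^[k] Q)‖ ≤ ε * (s.apply^[k] Q).ncard := by
  have hcard : ((s.apply^[k] Q).ncard : ℝ) = ∑ᶠ T ∈ Q, ((s.supertile k T.1).ncard : ℝ) := by
    rw [← nsmul_one, ← finsum_mem_const (hs.finite_iterate hfin k), hs.finsum_iterate hQ hfin]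
    refine finsum_mem_congr rfl fun T _ => ?_
    rw [finsum_mem_const (hs.finite_iterate (finite_singleton T) k), nsmul_one,
      s.iterate_apply_singleton, ncard_image_of_injective _ (Tile.move_injective _)]
  rw [hs.weylSum_iterate hQ hfin, hcard, mul_finsum_mem]
  refine (norm_finsum_mem_le hfin _).trans (finsum_mem_le_finsum_mem hfin fun T _ => ?_)
  rw [norm_weylSum_iterate_singleton hs]
  exact hε T.1

end IsPacking

/-- The tiles of the patch `P` that are not covered by those supertiles `s.apply^[k] {T}`, `T ∈ Q`,
which lie entirely in `P`. -/
def cutTiles (s : Substitution n) (k : ℕ) (Q P : Set (Tile n)) : Set (Tile n) :=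
  P \ s.apply^[k] {T ∈ Q | s.apply^[k] {T} ⊆ P}

theorem exists_notMem_of_mem_cutTiles {k : ℕ} {Q P : Set (Tile n)} (hP : P ⊆ s.apply^[k] Q)
    {t : Tile n} (ht : t ∈ s.cutTiles k Q P) :
    ∃ T, t ∈ s.apply^[k] {T} ∧ ∃ t' ∈ s.apply^[k] {T}, t' ∈ s.apply^[k] Q ∧ t' ∉ P := by
  obtain ⟨T, hT, htT⟩ := mem_iUnion₂.1 (s.iterate_apply_eq_biUnion k Q ▸ hP ht.1)
  have hTQ : s.apply^[k] {T} ⊆ s.apply^[k] Q :=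
    s.iterate_apply_mono k (singleton_subset_iff.2 hT)
  refine ⟨T, htT, ?_⟩
  by_contra! hTP
  have hTR : T ∈ {T ∈ Q | s.apply^[k] {T} ⊆ P} := ⟨hT, fun t' ht' => hTP t' ht' (hTQ ht')⟩
  exact ht.2 (s.iterate_apply_mono k (singleton_subset_iff.2 hTR) htT)

theorem IsPacking.norm_weylSum_le_add_ncard_cutTiles (hs : s.IsPacking) {p k : ℕ} {ε : ℝ}
    (hε0 : 0 ≤ ε) (hε : ∀ i, ‖weylSum p (s.supertile k i)‖ ≤ ε * (s.supertile k i).ncard)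
    {Q P : Set (Tile n)} (hQ : s.Packs Q) (hQfin : Q.Finite) (hPfin : P.Finite) :
    ‖weylSum p P‖ ≤ ε * P.ncard + (s.cutTiles k Q P).ncard := by
  set R := {T ∈ Q | s.apply^[k] {T} ⊆ P}
  have hRP : s.apply^[k] R ⊆ P := by
    rw [iterate_apply_eq_biUnion]
    exact iUnion₂_subset fun T hT => hT.2
  calc ‖weylSum p P‖ = ‖weylSum p (s.apply^[k] R) + weylSum p (s.cutTiles k Q P)‖ := by
        rw [weylSum, ← finsum_mem_add_sdiff hRP hPfin]
        rfl
    _ ≤ ‖weylSum p (s.apply^[k] R)‖ + ‖weylSum p (s.cutTiles k Q P)‖ := norm_add_le _ _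
    _ ≤ ε * (s.apply^[k] R).ncard + (s.cutTiles k Q P).ncard :=
        add_le_add (hs.norm_weylSum_iterate_le hε (hQ.mono (sep_subset _ _))
          (hQfin.subset (sep_subset _ _))) (norm_weylSum_le hPfin.sdiff)
    _ ≤ ε * P.ncard + (s.cutTiles k Q P).ncard := by
        gcongr

/-- The set `𝒯_r` of the tiles of `𝒯` that meet the closed ball of radius `r` about the origin. -/
def ballTiles (s : Substitution n) (𝒯 : Set (Tile n)) (r : ℝ) : Set (Tile n) :=
  {T ∈ 𝒯 | (s.support T ∩ Metric.closedBall 0 r).Nonempty}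

variable {𝒯 : Set (Tile n)}

theorem ballTiles_subset (r : ℝ) : s.ballTiles 𝒯 r ⊆ 𝒯 := sep_subset _ _

namespace IsTiling

theorem finite_ballTiles (h𝒯 : s.IsTiling 𝒯) (hs : s.IsPacking) (r : ℝ) :
    (s.ballTiles 𝒯 r).Finite := by
  obtain ⟨D, -, hdist⟩ := hs.exists_dist_le 0
  obtain ⟨c, -, hvol⟩ := hs.exists_ncard_mul_le_volume
  refine (hvol _ (h𝒯.packs.mono (ballTiles_subset r)) (Metric.closedBall 0 (D + r))
    measure_closedBall_lt_top.ne ?_).1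
  rintro T ⟨-, z, hz, hzr⟩ w hw
  exact (dist_triangle w z 0).trans
    (add_le_add (hdist T T (mem_singleton T) T (mem_singleton T) w hw z hz) hzr)

theorem closedBall_subset_biUnion_ballTiles (h𝒯 : s.IsTiling 𝒯) (r : ℝ) :
    Metric.closedBall 0 r ⊆ ⋃ T ∈ s.ballTiles 𝒯 r, s.support T := by
  intro z hz
  obtain ⟨T, hT, hzT⟩ := mem_iUnion₂.1 (h𝒯.covers ▸ mem_univ z)
  exact mem_iUnion₂.2 ⟨T, ⟨hT, z, hzT, hz⟩, hzT⟩

theorem isLittleO_id_ncard_ballTiles (h𝒯 : s.IsTiling 𝒯) (hs : s.IsPacking) :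
    (id : ℝ → ℝ) =o[atTop] fun r => ((s.ballTiles 𝒯 r).ncard : ℝ) := by
  obtain ⟨C, hC⟩ := Finite.exists_le fun i => volume.real (s.proto i)
  have hvol : ∀ T, volume.real (s.support T) ≤ C := fun T => by
    rw [support, measureReal_def, volume_image_motion]
    exact hC T.1
  have hbig : (fun r : ℝ => r ^ 2) =O[atTop] fun r => ((s.ballTiles 𝒯 r).ncard : ℝ) := by
    refine .of_bound (C / volume.real (Metric.ball (0 : ℂ) 1)) ?_
    filter_upwards [eventually_ge_atTop 0] with r hr
    have hfin := h𝒯.finite_ballTiles hs r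
    have hball : 0 < volume.real (Metric.ball (0 : ℂ) 1) :=
      ENNReal.toReal_pos (Metric.measure_ball_pos volume 0 one_pos).ne' measure_ball_lt_top.ne
    rw [Real.norm_of_nonneg (sq_nonneg r), Real.norm_natCast, div_mul_eq_mul_div,
      le_div_iff₀ hball]
    calc r ^ 2 * volume.real (Metric.ball (0 : ℂ) 1)
        = volume.real (Metric.closedBall (0 : ℂ) r) := by
          rw [Measure.addHaar_real_closedBall _ _ hr, Complex.finrank_real_complex]
      _ ≤ volume.real (⋃ T ∈ hfin.toFinset, s.support T) := by
          refine measureReal_mono ?_ (measure_biUnion_lt_top (Finset.finite_toSet _)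
            fun T _ => (hs.support_isCompact T).measure_lt_top).ne
          simpa using h𝒯.closedBall_subset_biUnion_ballTiles r
      _ ≤ ∑ T ∈ hfin.toFinset, volume.real (s.support T) := measureReal_biUnion_finset_le _ _
      _ ≤ C * (s.ballTiles 𝒯 r).ncard := by
          rw [ncard_eq_toFinset_card _ hfin, mul_comm]
          exact (Finset.sum_le_card_nsmul _ _ C fun T _ => hvol T).trans_eq (nsmul_eq_mul _ _)
  have hlin := isLittleO_pow_pow_atTop_of_lt (𝕜 := ℝ) one_lt_two
  simp only [pow_one] at hlin
  exact hlin.trans_isBigO hbig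

theorem tendsto_ncard_ballTiles (h𝒯 : s.IsTiling 𝒯) (hs : s.IsPacking) :
    Tendsto (fun r => ((s.ballTiles 𝒯 r).ncard : ℝ)) atTop atTop := by
  simpa only [Real.norm_natCast] using
    (h𝒯.isLittleO_id_ncard_ballTiles hs).isBigO.trans_tendsto_norm_atTop tendsto_norm_atTop_atTop

theorem le_norm_of_notMem_ballTiles (h𝒯 : s.IsTiling 𝒯) (hs : s.IsPacking) {Z : Set (Tile n)}
    {r : ℝ} (hZ : s.Packs Z) (hsub : s.ballTiles 𝒯 r ⊆ Z) {t : Tile n} (ht : t ∈ Z)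
    (htr : t ∉ s.ballTiles 𝒯 r) {z : ℂ} (hz : z ∈ s.support t) : r ≤ ‖z‖ := by
  by_contra! hzr
  obtain ⟨w, hwr, hwt⟩ := hs.inter_interior_support_nonempty Metric.isOpen_ball
    ⟨z, hz, mem_ball_zero_iff.2 hzr⟩
  obtain ⟨T, hT, hwT⟩ := mem_iUnion₂.1
    (h𝒯.closedBall_subset_biUnion_ballTiles r (Metric.ball_subset_closedBall hwr))
  obtain ⟨u, hut, huT⟩ := hs.inter_interior_support_nonempty isOpen_interior ⟨w, hwT, hwt⟩
  have hne : t ≠ T := fun h => htr (h ▸ hT)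
  exact Set.disjoint_left.1 (hZ ht (hsub hT) hne) hut huT

end IsTiling

theorem exists_ncard_supertile_le (s : Substitution n) (K : ℕ) :
    ∃ N, ∀ k < K, ∀ i, (s.supertile k i).ncard ≤ N := by
  obtain ⟨N, hN⟩ := Finite.exists_le fun x : Fin K × Fin n => (s.supertile x.1 x.2).ncard
  exact ⟨N, fun k hk i => hN (⟨k, hk⟩, i)⟩

namespace IsSubstitutionTiling

theorem exists_subset_iterate (h𝒯 : s.IsSubstitutionTiling 𝒯) (hs : s.IsPacking) (k : ℕ) :
    ∃ N, ∀ P ⊆ 𝒯, P.Finite → N < P.ncard → ∃ Q, Q.Finite ∧ s.Packs Q ∧ P ⊆ s.apply^[k] Q := by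
  obtain ⟨N, hN⟩ := s.exists_ncard_supertile_le k
  refine ⟨N, fun P hP hfin hcard => ?_⟩
  obtain ⟨K, i, g, hg⟩ := h𝒯.patch P hP hfin
  have hkK : k ≤ K := by
    by_contra! hlt
    have hle := ncard_le_ncard hg (hs.finite_supertile K i)
    rw [ncard_image_of_injective _ (Tile.move_injective g)] at hle
    exact (hcard.trans_le hle).not_ge (hN K hlt i)
  obtain ⟨l, rfl⟩ := Nat.exists_eq_add_of_le hkK
  refine ⟨Tile.move (dilate (s.factor ^ k)⁻¹ g⁻¹) '' s.supertile l i,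
    (hs.finite_supertile l i).image _, (hs.packs_supertile l i).move _, fun T hT => ?_⟩
  rw [iterate_apply_move, dilate_dilate, mul_inv_cancel₀ (pow_pos hs.factor_pos k).ne',
    dilate_one_left, ← supertile_add]
  exact ⟨T.move g, hg (mem_image_of_mem _ hT), by rw [← Tile.move_mul, inv_mul_cancel,
    Tile.move_one]⟩

theorem exists_norm_weylSum_ballTiles_le (h𝒯 : s.IsSubstitutionTiling 𝒯) (hs : s.IsPacking)
    {p k : ℕ} {ε : ℝ} (hε0 : 0 ≤ ε)
    (hε : ∀ i, ‖weylSum p (s.supertile k i)‖ ≤ ε * (s.supertile k i).ncard) :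
    ∃ C, ∀ᶠ r in atTop,
      ‖weylSum p (s.ballTiles 𝒯 r)‖ ≤ ε * (s.ballTiles 𝒯 r).ncard + C * r := by
  obtain ⟨D, hD, hdist⟩ := hs.exists_dist_le k
  obtain ⟨N, hN⟩ := h𝒯.exists_subset_iterate hs k
  obtain ⟨C, hC⟩ := hs.exists_ncard_le_mul_of_subset_annulus D hD
  refine ⟨C, ?_⟩
  filter_upwards [eventually_ge_atTop D,
    (h𝒯.isTiling.tendsto_ncard_ballTiles hs).eventually_gt_atTop (N : ℝ)] with r hrD hrN
  have hfin := h𝒯.isTiling.finite_ballTiles hs r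
  obtain ⟨Q, hQfin, hQ, hsub⟩ := hN _ (ballTiles_subset r) hfin (Nat.cast_lt.1 hrN)
  refine (hs.norm_weylSum_le_add_ncard_cutTiles hε0 hε hQ hQfin hfin).trans ?_
  gcongr
  refine hC r hrD _ ((hs.packs_iterate hQ k).mono (sdiff_subset.trans hsub)) ?_
  intro t ht w hw
  obtain ⟨T, htT, t', ht'T, ht'Q, ht'⟩ := exists_notMem_of_mem_cutTiles hsub ht
  obtain ⟨-, z, hz, hzr⟩ := ht.1
  obtain ⟨z', hz'⟩ := hs.support_interior_nonempty t'
  have hz'r : r ≤ ‖z'‖ := h𝒯.isTiling.le_norm_of_notMem_ballTiles hs (hs.packs_iterate hQ k)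
    hsub ht'Q ht' (interior_subset hz')
  have hwz : ‖w - z‖ ≤ D := dist_eq_norm w z ▸ hdist T t htT t htT w hw z hz
  have hwz' : ‖z' - w‖ ≤ D := dist_eq_norm z' w ▸
    hdist T t' ht'T t htT z' (interior_subset hz') w hw
  rw [mem_closedBall_zero_iff] at hzr
  simp only [Set.mem_sdiff, mem_closedBall_zero_iff, mem_ball_zero_iff, not_lt]
  constructor <;> linarith [norm_sub_norm_le w z, norm_sub_norm_le z' w]

theorem isLittleO_weylSum_ballTiles (h𝒯 : s.IsSubstitutionTiling 𝒯) (hs : s.IsPacking) {p : ℕ}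
    (hp : ∀ i, (fun k => weylSum p (s.supertile k i)) =o[atTop]
      fun k => ((s.supertile k i).ncard : ℝ)) :
    (fun r => weylSum p (s.ballTiles 𝒯 r)) =o[atTop]
      fun r => ((s.ballTiles 𝒯 r).ncard : ℝ) := by
  refine isLittleO_iff.2 fun ε hε => ?_
  obtain ⟨k, hk⟩ := (eventually_all.2 fun i => (hp i).def (half_pos hε)).exists
  simp only [Real.norm_natCast] at hk
  obtain ⟨C, hC⟩ := h𝒯.exists_norm_weylSum_ballTiles_le hs (half_pos hε).le hk
  have hr := ((h𝒯.isTiling.isLittleO_id_ncard_ballTiles hs).const_mul_left C).def (half_pos hε)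
  filter_upwards [hC, hr] with r hC hr
  rw [Real.norm_natCast, id] at *
  linarith [Real.le_norm_self (C * r)]

end IsSubstitutionTiling

end Substitution

/-! ### Weyl's criterion -/

section Weyl

open MeasureTheory AddCircle BoundedContinuousFunction

variable {T : ℝ} [hT : Fact (0 < T)] {ι : Type*} {L : Filter ι}
  {μ : ι → ProbabilityMeasure (AddCircle T)}

theorem tendsto_of_tendsto_integral_fourier {ν : ProbabilityMeasure (AddCircle T)}
    (h : ∀ k : ℤ, Tendsto (fun i => ∫ x, fourier k x ∂(μ i : Measure (AddCircle T))) L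
      (𝓝 (∫ x, fourier k x ∂(ν : Measure (AddCircle T))))) :
    Tendsto μ L (𝓝 ν) := by
  have integrable (ξ : ProbabilityMeasure (AddCircle T)) (f : C(AddCircle T, ℂ)) :
      Integrable f (ξ : Measure (AddCircle T)) := (mkOfCompact f).integrable _
  refine ProbabilityMeasure.tendsto_of_tight_of_separatesPoints ℂ
    (A := fourierSubalgebra.comap (toContinuousMapStarₐ ℂ)) .of_compactSpace ?_ fun g hg => ?_
  · refine Subalgebra.separatesPoints_monotone (fun f hf => ?_) fourierSubalgebra_separatesPoints
    exact ⟨mkOfCompact f, hf, rfl⟩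
  · have hspan : ∀ f ∈ Submodule.span ℂ (range (@fourier T)),
        Tendsto (fun i => ∫ x, f x ∂(μ i : Measure (AddCircle T))) L
          (𝓝 (∫ x, f x ∂(ν : Measure (AddCircle T)))) := fun f hf => by
      induction hf using Submodule.span_induction with
      | mem f hf =>
        obtain ⟨k, rfl⟩ := hf
        exact h k
      | zero => simpa only [ContinuousMap.zero_apply, integral_zero] using tendsto_const_nhds
      | add f g _ _ hf hg =>
        simpa only [ContinuousMap.add_apply, integral_add (integrable _ f) (integrable _ g)]
          using hf.add hg
      | smul c f _ hf =>
        simpa only [ContinuousMap.smul_apply, integral_smul] using hf.const_smul c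
    exact hspan g.toContinuousMap (by rwa [← fourierSubalgebra_coe])

theorem integral_fourier_haarAddCircle (k : ℤ) :
    ∫ x, fourier k x ∂(haarAddCircle (T := T)) = if k = 0 then 1 else 0 := by
  simpa [fourierCoeff, Pi.single_apply, eq_comm] using
    congrFun (fourierCoeff_fourier (T := T) k) 0

theorem tendsto_haarAddCircle_of_integral_fourier
    (h : ∀ p : ℕ, 0 < p →
      Tendsto (fun i => ∫ x, fourier p x ∂(μ i : Measure (AddCircle T))) L (𝓝 0)) :
    Tendsto μ L (𝓝 ⟨haarAddCircle, inferInstance⟩) := by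
  refine tendsto_of_tendsto_integral_fourier fun k => ?_
  rw [ProbabilityMeasure.coe_mk, integral_fourier_haarAddCircle]
  obtain ⟨p, rfl | rfl⟩ := k.eq_nat_or_neg <;> obtain rfl | hp := p.eq_zero_or_pos
  · simpa using tendsto_const_nhds
  · simpa [hp.ne'] using h p hp
  · simpa using tendsto_const_nhds
  · have hconj := (Complex.continuous_conj.tendsto 0).comp (h p hp)
    simpa only [Function.comp_def, ← integral_conj, ← fourier_neg, map_zero, neg_eq_zero,
      Nat.cast_eq_zero, hp.ne', if_false] using hconj

theorem haarAddCircle_closedBall (c : AddCircle T) {r : ℝ} (hr : 2 * r ≤ T) :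
    haarAddCircle (Metric.closedBall c r) = ENNReal.ofReal (2 * r / T) := by
  have hT0 : ENNReal.ofReal T ≠ 0 := by simpa using hT.out
  have hvol := volume_closedBall T (x := c) r
  rw [min_eq_right hr, volume_eq_smul_haarAddCircle, Measure.smul_apply, smul_eq_mul] at hvol
  rw [ENNReal.ofReal_div_of_pos hT.out, ← hvol,
    mul_comm, ENNReal.mul_div_cancel_right hT0 ENNReal.ofReal_ne_top]

theorem haarAddCircle_frontier_closedBall (c : AddCircle T) (r : ℝ) :
    haarAddCircle (frontier (Metric.closedBall c r)) = 0 := by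
  have hnull : (volume : Measure (AddCircle T)) (frontier (Metric.closedBall c r)) = 0 := by
    refine measure_mono_null ?_ (ae_le_set.1 (closedBall_ae_eq_ball (x := c) (ε := r)).le)
    rw [Metric.isClosed_closedBall.frontier_eq]
    exact sdiff_subset_sdiff_right Metric.ball_subset_interior_closedBall
  rw [volume_eq_smul_haarAddCircle, Measure.smul_apply, smul_eq_mul] at hnull
  exact (mul_eq_zero.1 hnull).resolve_left (by simpa using hT.out)

theorem tendsto_real_closedBall
    (h : ∀ p : ℕ, 0 < p →
      Tendsto (fun i => ∫ x, fourier p x ∂(μ i : Measure (AddCircle T))) L (𝓝 0))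
    (c : AddCircle T) {r : ℝ} (hr0 : 0 ≤ r) (hr : 2 * r ≤ T) :
    Tendsto (fun i => (μ i : Measure (AddCircle T)).real (Metric.closedBall c r)) L
      (𝓝 (2 * r / T)) := by
  have hlim := ProbabilityMeasure.tendsto_measure_of_null_frontier_of_tendsto'
    (tendsto_haarAddCircle_of_integral_fourier h) (haarAddCircle_frontier_closedBall c r)
  rw [ProbabilityMeasure.coe_mk, haarAddCircle_closedBall c hr] at hlim
  have hreal := (ENNReal.tendsto_toReal ENNReal.ofReal_ne_top).comp hlim
  rwa [ENNReal.toReal_ofReal (by have := hT.out; positivity)] at hreal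

theorem coe_mem_closedBall_iff {x y b : ℝ} (hx : 0 ≤ x) (hy : y < T)
    (hb : b ∈ Ico 0 T) :
    (b : AddCircle T) ∈ Metric.closedBall (((x + y) / 2 : ℝ) : AddCircle T) ((y - x) / 2) ↔
      b ∈ Icc x y := by
  rw [← mem_preimage, coe_real_preimage_closedBall_eq_iUnion, mem_iUnion]
  simp only [Metric.mem_closedBall, Real.dist_eq, abs_le, mem_Icc, zsmul_eq_mul]
  constructor
  · rintro ⟨k, hk⟩
    have hk0 : k = 0 := by
      have h1 : ((-1 : ℤ) : ℝ) * T < k * T := by push_cast; linarith [hb.1]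
      have h2 : (k : ℝ) * T < (1 : ℤ) * T := by push_cast; linarith [hb.2]
      rw [mul_lt_mul_iff_left₀ hT.out, Int.cast_lt] at h1 h2
      lia
    rw [hk0, Int.cast_zero, zero_mul, add_zero] at hk
    constructor <;> linarith
  · rintro ⟨h1, h2⟩
    exact ⟨0, by rw [Int.cast_zero, zero_mul, add_zero]; constructor <;> linarith⟩

end Weyl

/-! ### Equidistribution of angles -/

section Empirical

open MeasureTheory

variable {α β : Type*} [MeasurableSpace β]

/-- The empirical distribution of the points `a t`, `t ∈ F`: the average of the point masses at
these points. -/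
def empirical (a : α → β) (F : Finset α) : Measure β :=
  (F.card : ENNReal)⁻¹ • ∑ t ∈ F, Measure.dirac (a t)

theorem isProbabilityMeasure_empirical (a : α → β) {F : Finset α} (hF : F.Nonempty) :
    IsProbabilityMeasure (empirical a F) where
  measure_univ := by
    simp [empirical, ENNReal.inv_mul_cancel (Nat.cast_ne_zero.2 hF.card_ne_zero)
      (ENNReal.natCast_ne_top _)]

open Classical in
theorem empirical_real (a : α → β) (F : Finset α) {E : Set β} (hE : MeasurableSet E) :
    (empirical a F).real E = ((F.filter fun t => a t ∈ E).card : ℝ) / F.card := by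
  simp [empirical, Measure.real, hE, indicator_apply, Finset.sum_boole, div_eq_inv_mul]

theorem integral_empirical [MeasurableSingletonClass β] (a : α → β) (F : Finset α)
    (f : β → ℂ) :
    ∫ x, f x ∂(empirical a F) = (∑ t ∈ F, f (a t)) / F.card := by
  rw [empirical, integral_smul_measure,
    integral_finsetSum_measure fun t _ => integrable_dirac enorm_lt_top]
  simp [div_eq_inv_mul]

end Empirical

section Angle

open MeasureTheory

variable {n : ℕ}

theorem Tile.angle_mem (T : Tile n) : T.angle ∈ Ico 0 (2 * Real.pi) :=
  zero_add (2 * Real.pi) ▸ toIcoMod_mem_Ico Real.two_pi_pos 0 (Complex.arg T.dir)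

theorem Tile.exp_angle (T : Tile n) : Complex.exp (T.angle * Complex.I) = T.dir := by
  have harg : Complex.exp (Complex.arg T.dir * Complex.I) = T.dir := by
    simpa only [T.norm_dir, Complex.ofReal_one, one_mul] using Complex.norm_mul_exp_arg_mul_I T.dir
  rw [show T.angle = toIcoMod Real.two_pi_pos 0 (Complex.arg T.dir) from rfl, toIcoMod]
  push_cast [zsmul_eq_mul]
  rw [sub_mul, mul_assoc, Complex.exp_sub, Complex.exp_int_mul_two_pi_mul_I, div_one, harg]

theorem fourier_angle (p : ℕ) (T : Tile n) :
    fourier p (T.angle : AddCircle (2 * Real.pi)) = T.dir ^ p := by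
  rw [fourier_coe_apply, ← T.exp_angle, ← Complex.exp_nat_mul]
  congr 1
  have := Complex.ofReal_ne_zero.2 Real.pi_ne_zero
  push_cast
  field_simp

theorem tendsto_ncard_angle_div {ι : Type*} {L : Filter ι} {P : ι → Set (Tile n)}
    (hfin : ∀ i, (P i).Finite) (hne : ∀ᶠ i in L, (P i).Nonempty)
    (hW : ∀ p : ℕ, 0 < p → (fun i => weylSum p (P i)) =o[L] fun i => ((P i).ncard : ℝ))
    {x y : ℝ} (hx : 0 ≤ x) (hxy : x < y) (hy : y < 2 * Real.pi) :
    Tendsto (fun i => ({T ∈ P i | T.angle ∈ Icc x y}.ncard : ℝ) / (P i).ncard) L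
      (𝓝 ((y - x) / (2 * Real.pi))) := by
  have : Fact (0 < 2 * Real.pi) := ⟨Real.two_pi_pos⟩
  let a (T : Tile n) : AddCircle (2 * Real.pi) := T.angle
  let μ (i : {i // (P i).Nonempty}) : ProbabilityMeasure (AddCircle (2 * Real.pi)) :=
    ⟨empirical a (hfin i).toFinset,
      isProbabilityMeasure_empirical a ((hfin i).toFinset_nonempty.2 i.2)⟩
  have hfourier (p : ℕ) (hp : 0 < p) :
      Tendsto (fun i => ∫ z, fourier p z ∂(μ i : Measure (AddCircle (2 * Real.pi))))
        (comap Subtype.val L) (𝓝 0) := by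
    refine tendsto_zero_iff_norm_tendsto_zero.2 <|
      ((hW p hp).norm_left.tendsto_div_nhds_zero.comp tendsto_comap).congr fun i => ?_
    simp only [μ, a, ProbabilityMeasure.coe_mk, integral_empirical, fourier_angle, weylSum,
      finsum_mem_eq_finite_toFinset_sum _ (hfin i), ncard_eq_toFinset_card _ (hfin i), norm_div,
      Complex.norm_natCast, Function.comp_apply]
  have hball := tendsto_real_closedBall hfourier (((x + y) / 2 : ℝ) : AddCircle (2 * Real.pi))
    (r := (y - x) / 2) (by linarith) (by linarith)
  rw [mul_div_cancel₀ _ two_ne_zero] at hball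
  rw [← tendsto_comap'_iff (i := (Subtype.val : {i // (P i).Nonempty} → ι)) (by simpa)]
  refine hball.congr fun i => ?_
  classical
  refine (empirical_real a _ Metric.isClosed_closedBall.measurableSet).trans ?_
  simp only [a, coe_mem_closedBall_iff hx hy (Tile.angle_mem _), Function.comp_apply]
  rw [ncard_eq_toFinset_card _ (hfin i), ncard_eq_toFinset_card _ ((hfin i).sep _)]
  congr 3
  ext T
  simp only [Finset.mem_filter, Finite.mem_toFinset, mem_ofPred_eq]

end Angle

namespace Substitution

variable {n : ℕ} {s : Substitution n} {𝒯 : Set (Tile n)}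

theorem tendsto_ncard_ballTiles_angle_div (hs : s.IsPacking)
    (hW : ∀ p : ℕ, 0 < p → ∀ i, (fun k => weylSum p (s.supertile k i)) =o[atTop]
      fun k => ((s.supertile k i).ncard : ℝ))
    (h𝒯 : s.IsSubstitutionTiling 𝒯) {x y : ℝ} (hx : 0 ≤ x) (hxy : x < y)
    (hy : y < 2 * Real.pi) :
    Tendsto (fun r => ({T ∈ s.ballTiles 𝒯 r | T.angle ∈ Icc x y}.ncard : ℝ) /
      (s.ballTiles 𝒯 r).ncard) atTop (𝓝 ((y - x) / (2 * Real.pi))) := by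
  refine tendsto_ncard_angle_div (h𝒯.isTiling.finite_ballTiles hs) ?_
    (fun p hp => h𝒯.isLittleO_weylSum_ballTiles hs (hW p hp)) hx hxy hy
  filter_upwards [(h𝒯.isTiling.tendsto_ncard_ballTiles hs).eventually_gt_atTop 0] with r hr
  exact nonempty_of_ncard_ne_zero (by exact_mod_cast hr.ne')

theorem isLittleO_weylSum_image_Iio (hs : s.IsPacking) {p : ℕ}
    (hp : ∀ i, (fun k => weylSum p (s.supertile k i)) =o[atTop]
      fun k => ((s.supertile k i).ncard : ℝ))
    {e : ℕ → Tile n} (he : Function.Injective e) :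
    (fun l => weylSum p (e '' Iio l)) =o[atTop ⊓ 𝓟 {l | s.IsSupertile (e '' Iio l)}]
      fun l => ((e '' Iio l).ncard : ℝ) := by
  refine Asymptotics.isLittleO_iff.2 fun ε hε => ?_
  obtain ⟨K, hK⟩ := eventually_atTop.1 (eventually_all.2 fun i => (hp i).def hε)
  obtain ⟨N, hN⟩ := s.exists_ncard_supertile_le K
  rw [eventually_inf_principal]
  filter_upwards [eventually_gt_atTop N] with l hl
  rintro ⟨k, i, g, hg⟩
  have hcard : (s.supertile k i).ncard = l := by
    rw [← ncard_image_of_injective _ (Tile.move_injective g), ← hg,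
      ncard_image_of_injective _ he, ncard_Iio_nat]
  have hKk : K ≤ k := not_lt.1 fun hlt => (hN k hlt i).not_gt (hcard ▸ hl)
  rw [hg, norm_weylSum_move (hs.finite_supertile k i),
    ncard_image_of_injective _ (Tile.move_injective g)]
  exact hK k hKk i

theorem sum_indicator_angle {e : ℕ → Tile n} (he : Function.Injective e) (A : Set ℝ) (l : ℕ) :
    ∑ k ∈ Finset.range l, A.indicator (fun _ => (1 : ℝ)) (e k).angle =
      ({T ∈ e '' Iio l | T.angle ∈ A}.ncard : ℝ) := by
  classical
  have hset : {T ∈ e '' Iio l | T.angle ∈ A} =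
      e '' ((Finset.range l).filter fun k => (e k).angle ∈ A : Finset ℕ) := by
    ext T
    simp only [mem_ofPred_eq, mem_image, Finset.coe_filter, Finset.mem_range, mem_Iio]
    aesop
  rw [hset, ncard_image_of_injective _ he, ncard_coe_finset, Finset.natCast_card_filter]
  simp only [indicator_apply]

theorem IsPacking.hasStatisticalCircularSymmetry (hs : s.IsPacking)
    (hprim : s.matrix.IsPrimitive)
    (hW : ∀ p : ℕ, 0 < p → ∀ i, (fun k => weylSum p (s.supertile k i)) =o[atTop]
      fun k => ((s.supertile k i).ncard : ℝ))
    (h𝒯 : s.IsSubstitutionTiling 𝒯) :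
    s.HasStatisticalCircularSymmetry 𝒯 where
  primitive := hprim
  of_balls x y hx hxy hy := by
    simpa only [ballTiles, mem_ofPred_eq, and_assoc] using
      tendsto_ncard_ballTiles_angle_div hs hW h𝒯 hx hxy hy
  of_supertiles e he _ _ x y hx hxy hy := by
    have hne : ∀ᶠ l : ℕ in atTop ⊓ 𝓟 {l | s.IsSupertile (e '' Iio l)}, (e '' Iio l).Nonempty :=
      .filter_mono inf_le_left <| (eventually_gt_atTop 0).mono fun l hl => ⟨e 0, 0, hl, rfl⟩
    refine (tendsto_ncard_angle_div (fun l => (finite_Iio l).image e) hne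
      (fun p hp => isLittleO_weylSum_image_Iio hs (hW p hp) he) hx hxy hy).congr fun l => ?_
    rw [sum_indicator_angle he, ncard_image_of_injective _ he, ncard_Iio_nat, one_div_mul_eq_div]

end Substitution

/-! ### The legs of the prototiles -/

section Legs

variable {m j : ℕ} (hjm : j < m)

theorem factor_pos : 0 < pythagorasFactor hjm := (existsUnique_factor hjm).choose_spec.1.1

theorem factor_pow_two_mul :
    pythagorasFactor hjm ^ (2 * m) = pythagorasFactor hjm ^ (2 * j) + 1 :=
  (existsUnique_factor hjm).choose_spec.1.2

theorem one_lt_factor : 1 < pythagorasFactor hjm := by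
  by_contra! hle
  have h1 := pow_le_one₀ (n := 2 * m) (factor_pos hjm).le hle
  have h2 : 0 < pythagorasFactor hjm ^ (2 * j) := pow_pos (factor_pos hjm) _
  linarith [factor_pow_two_mul hjm]

theorem shortLeg_pos : 0 < shortLeg hjm := inv_pos.2 (pow_pos (factor_pos hjm) _)

theorem factor_pow_mul_shortLeg : pythagorasFactor hjm ^ m * shortLeg hjm = 1 :=
  mul_inv_cancel₀ (pow_pos (factor_pos hjm) _).ne'

theorem shortLeg_lt_one : shortLeg hjm < 1 :=
  inv_lt_one_of_one_lt₀ (one_lt_pow₀ (one_lt_factor hjm) (Nat.ne_zero_of_lt hjm))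

theorem shortLeg_sq_add_longLeg_sq : shortLeg hjm ^ 2 + longLeg hjm ^ 2 = 1 := by
  have : shortLeg hjm ^ 2 ≤ 1 := pow_le_one₀ (shortLeg_pos hjm).le (shortLeg_lt_one hjm).le
  rw [longLeg, Real.sq_sqrt (sub_nonneg.2 this), add_sub_cancel]

theorem longLeg_eq : longLeg hjm = pythagorasFactor hjm ^ j * shortLeg hjm := by
  rw [longLeg, Real.sqrt_eq_iff_mul_self_eq_of_pos
    (mul_pos (pow_pos (factor_pos hjm) _) (shortLeg_pos hjm))]
  have h1 := factor_pow_two_mul hjm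
  have h2 := factor_pow_mul_shortLeg hjm
  rw [mul_comm 2 m, mul_comm 2 j, pow_mul, pow_mul] at h1
  linear_combination (-shortLeg hjm ^ 2) * h1 +
    (pythagorasFactor hjm ^ m * shortLeg hjm + 1) * h2

theorem longLeg_pos : 0 < longLeg hjm := by
  rw [longLeg_eq]
  exact mul_pos (pow_pos (factor_pos hjm) _) (shortLeg_pos hjm)

theorem factor_pow_mul_longLeg :
    pythagorasFactor hjm ^ m * longLeg hjm = pythagorasFactor hjm ^ j := by
  rw [longLeg_eq, mul_left_comm, factor_pow_mul_shortLeg, mul_one]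

theorem factor_pow_j_mul_longLeg :
    pythagorasFactor hjm ^ j * longLeg hjm = pythagorasFactor hjm ^ m - shortLeg hjm := by
  have h1 := shortLeg_sq_add_longLeg_sq hjm
  have h2 := factor_pow_mul_shortLeg hjm
  have h3 := factor_pow_mul_longLeg hjm
  linear_combination (-longLeg hjm) * h3 + pythagorasFactor hjm ^ m * h1 - shortLeg hjm * h2

theorem factor_pow_mul_apex :
    (pythagorasFactor hjm : ℂ) ^ m * apex hjm =
      -1 + (pythagorasFactor hjm : ℂ) ^ j * Complex.I := by
  have h1 := congrArg Complex.ofReal (factor_pow_mul_shortLeg hjm)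
  have h2 := congrArg Complex.ofReal (factor_pow_mul_longLeg hjm)
  push_cast at h1 h2
  rw [apex]
  linear_combination -h1 + Complex.I * h2

theorem exp_theta :
    Complex.exp (theta hjm * Complex.I) = shortLeg hjm + longLeg hjm * Complex.I := by
  rw [Complex.exp_mul_I, ← Complex.ofReal_cos, ← Complex.ofReal_sin, theta,
    Real.cos_arccos (by linarith [shortLeg_pos hjm]) (shortLeg_lt_one hjm).le, Real.sin_arccos,
    longLeg]

theorem exp_neg_theta :
    Complex.exp ((-theta hjm : ℝ) * Complex.I) = shortLeg hjm - longLeg hjm * Complex.I := by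
  have h := congrArg (starRingEnd ℂ) (exp_theta hjm)
  rw [← Complex.exp_conj] at h
  simp only [map_mul, map_add, Complex.conj_ofReal, Complex.conj_I] at h
  rw [Complex.ofReal_neg, neg_mul, ← mul_neg, h]
  ring

theorem exp_pi_div_two : Complex.exp ((Real.pi / 2 : ℝ) * Complex.I) = Complex.I := by
  push_cast
  exact Complex.exp_pi_div_two_mul_I

theorem exp_neg_pi_div_two : Complex.exp ((-(Real.pi / 2) : ℝ) * Complex.I) = -Complex.I := by
  rw [← neg_div]
  push_cast
  exact Complex.exp_neg_pi_div_two_mul_I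

theorem exp_neg_theta_sub_pi_div_two :
    Complex.exp ((-theta hjm - Real.pi / 2 : ℝ) * Complex.I) =
      -(longLeg hjm : ℂ) - shortLeg hjm * Complex.I := by
  rw [sub_eq_add_neg, Complex.ofReal_add, add_mul, Complex.exp_add, exp_neg_theta,
    exp_neg_pi_div_two]
  linear_combination (longLeg hjm : ℂ) * Complex.I_mul_I

end Legs

theorem disjoint_interior_convexHull_of_le_of_le {E : Type*} [NormedAddCommGroup E]
    [NormedSpace ℝ E] {f : StrongDual ℝ E} (hf : f ≠ 0) {c : ℝ} {X Y : Set E}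
    (hX : ∀ x ∈ X, f x ≤ c) (hY : ∀ y ∈ Y, c ≤ f y) :
    Disjoint (interior (convexHull ℝ X)) (interior (convexHull ℝ Y)) := by
  have hpre (S : Set ℝ) : interior (f ⁻¹' S) = f ⁻¹' interior S :=
    (f.isOpenMap_of_ne_zero hf).preimage_interior_eq_interior_preimage f.continuous S |>.symm
  have hX' : convexHull ℝ X ⊆ f ⁻¹' Iic c :=
    convexHull_min hX (convex_halfSpace_le f.isLinear c)
  have hY' : convexHull ℝ Y ⊆ f ⁻¹' Ici c :=
    convexHull_min hY (convex_halfSpace_ge f.isLinear c)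
  refine .mono (interior_mono hX') (interior_mono hY') ?_
  rw [hpre, hpre, interior_Iic, interior_Ici]
  exact ((Iic_disjoint_Ioi le_rfl).mono_left Iio_subset_Iic_self).preimage f

section Triangles

open Substitution
open scoped Pointwise

variable {m j : ℕ} (hjm : j < m)

theorem triangle_eq (i : Fin m) :
    triangle hjm i = convexHull ℝ {0, -((pythagorasFactor hjm : ℂ) ^ (i : ℕ) * shortLeg hjm),
      (pythagorasFactor hjm : ℂ) ^ (i : ℕ) * apex hjm} := by
  refine ((LinearMap.mulLeft ℝ ((pythagorasFactor hjm : ℂ) ^ (i : ℕ))).image_convexHull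
    {0, -(shortLeg hjm : ℂ), apex hjm}).trans ?_
  rw [image_insert_eq, image_pair]
  simp

theorem triangle_eq_smul (i : Fin m) :
    triangle hjm i = (pythagorasFactor hjm ^ (i : ℕ)) •
      convexHull ℝ {0, -(shortLeg hjm : ℂ), apex hjm} := by
  rw [triangle, ← image_smul]
  simp

theorem support_pythagoras (i : Fin m) (g : Motion) :
    (pythagoras hjm).support (i, g) = convexHull ℝ
      {g 0, g (-((pythagorasFactor hjm : ℂ) ^ (i : ℕ) * shortLeg hjm)),
        g ((pythagorasFactor hjm : ℂ) ^ (i : ℕ) * apex hjm)} := by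
  change g '' triangle hjm i = _
  rw [triangle_eq]
  refine ((g.toAffineEquiv : ℂ →ᵃ[ℝ] ℂ).image_convexHull _).trans ?_
  rw [image_insert_eq, image_pair]
  rfl

theorem smul_triangle (c : ℝ) (i : Fin m) :
    c • triangle hjm i = convexHull ℝ
      {0, -(c * ((pythagorasFactor hjm : ℂ) ^ (i : ℕ) * shortLeg hjm)),
        c * ((pythagorasFactor hjm : ℂ) ^ (i : ℕ) * apex hjm)} := by
  rw [triangle_eq, ← convexHull_smul, ← image_smul, image_insert_eq, image_pair]
  simp

theorem convex_triangle (i : Fin m) : Convex ℝ (triangle hjm i) := by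
  rw [triangle_eq]
  exact convex_convexHull ℝ _

theorem isCompact_triangle (i : Fin m) : IsCompact (triangle hjm i) := by
  rw [triangle_eq]
  exact (toFinite _).isCompact_convexHull ℝ

theorem affineIndependent_triangle :
    AffineIndependent ℝ ![0, -(shortLeg hjm : ℂ), apex hjm] := by
  rw [affineIndependent_iff_not_collinear_set, collinear_iff_of_mem (p₀ := 0) (by simp)]
  rintro ⟨v, hv⟩
  obtain ⟨r, hr⟩ := hv (-(shortLeg hjm : ℂ)) (by simp)
  obtain ⟨r', hr'⟩ := hv (apex hjm) (by simp)
  have hre : -shortLeg hjm = r * v.re := by simpa using congrArg Complex.re hr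
  have him : 0 = r * v.im := by simpa using congrArg Complex.im hr
  have him' : longLeg hjm = r' * v.im := by simpa [apex] using congrArg Complex.im hr'
  have ha := shortLeg_pos hjm
  have hb := longLeg_pos hjm
  rcases mul_eq_zero.1 him.symm with h | h
  · rw [h, zero_mul] at hre
    linarith
  · rw [h, mul_zero] at him'
    linarith

theorem interior_triangle_nonempty (i : Fin m) : (interior (triangle hjm i)).Nonempty := by
  rw [triangle_eq_smul, interior_smul₀ (pow_pos (factor_pos hjm) _).ne']
  refine Nonempty.smul_set ?_
  rw [interior_convexHull_nonempty_iff_affineSpan_eq_top]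
  have h := (affineIndependent_triangle hjm).affineSpan_eq_top_iff_card_eq_finrank_add_one.2
    (by simp)
  rwa [Matrix.range_cons, Matrix.range_cons_cons_empty] at h

end Triangles

section Pythagoras

open Substitution
open scoped Pointwise

variable {m j : ℕ} (hjm : j < m)

/-- The smaller tile in the dissection of the largest enlarged prototile. -/
def phiTile : Tile m := (⟨0, by omega⟩, mirror (-theta hjm) 0)

/-- The larger tile in the dissection of the largest enlarged prototile. -/
def psiTile : Tile m := (⟨j, hjm⟩, mirror (-theta hjm - Real.pi / 2) (-1))

theorem support_phiTile : (pythagoras hjm).support (phiTile hjm) =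
    convexHull ℝ {0, (shortLeg hjm : ℂ) * apex hjm, -1} := by
  have h := congrArg Complex.ofReal (shortLeg_sq_add_longLeg_sq hjm)
  push_cast at h
  rw [phiTile, support_pythagoras]
  simp only [mirror_apply, exp_neg_theta, pow_zero, one_mul, map_neg, Complex.conj_ofReal, apex,
    map_add, map_mul, Complex.conj_I, map_zero, mul_zero, add_zero]
  congr 3
  · ring
  · congr 1
    linear_combination -h + (longLeg hjm : ℂ) ^ 2 * Complex.I_sq

theorem support_psiTile : (pythagoras hjm).support (psiTile hjm) =
    convexHull ℝ {-1, (shortLeg hjm : ℂ) * apex hjm,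
      (pythagorasFactor hjm : ℂ) ^ m * apex hjm} := by
  have h := congrArg Complex.ofReal (shortLeg_sq_add_longLeg_sq hjm)
  have h' := congrArg Complex.ofReal (longLeg_eq hjm)
  push_cast at h h'
  rw [factor_pow_mul_apex, psiTile, support_pythagoras]
  simp only [mirror_apply, exp_neg_theta_sub_pi_div_two, ← h', map_neg,
    Complex.conj_ofReal, apex, map_pow, map_add, map_mul, Complex.conj_I, map_zero, mul_zero,
    zero_add]
  congr 3
  · linear_combination h
  · congr 1
    linear_combination (pythagorasFactor hjm : ℂ) ^ j * Complex.I * h +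
      (pythagorasFactor hjm : ℂ) ^ j * shortLeg hjm * longLeg hjm * Complex.I_sq

theorem pythagoras_rule_of_lt {i : Fin m} (h : (i : ℕ) + 1 < m) :
    (pythagoras hjm).rule i = {(⟨i + 1, h⟩, 1)} := dif_pos h

theorem pythagoras_rule_of_not_lt {i : Fin m} (h : ¬(i : ℕ) + 1 < m) :
    (pythagoras hjm).rule i = {phiTile hjm, psiTile hjm} := dif_neg h

theorem disjoint_interior_phiTile_psiTile :
    Disjoint (interior ((pythagoras hjm).support (phiTile hjm)))
      (interior ((pythagoras hjm).support (psiTile hjm))) := by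
  have ha := shortLeg_pos hjm
  have hb := longLeg_pos hjm
  have hab := shortLeg_sq_add_longLeg_sq hjm
  -- The altitude from `-1` to `a * apex` is perpendicular to `apex = -a + i b`.
  let f : StrongDual ℝ ℂ := -shortLeg hjm • Complex.reCLM + longLeg hjm • Complex.imCLM
  have hf (z : ℂ) : f z = -shortLeg hjm * z.re + longLeg hjm * z.im := rfl
  have hf0 : f ≠ 0 := fun h => hb.ne' (by simpa [hf] using DFunLike.congr_fun h Complex.I)
  have hfoot : f (shortLeg hjm * apex hjm) = shortLeg hjm := by
    simp [hf, apex]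
    linear_combination shortLeg hjm * hab
  rw [support_phiTile, support_psiTile]
  refine disjoint_interior_convexHull_of_le_of_le hf0 (c := shortLeg hjm) ?_ ?_
  · rintro z (rfl | rfl | rfl)
    · simpa using ha.le
    · exact hfoot.le
    · simp [hf]
  · rintro z (rfl | rfl | rfl)
    · simp [hf]
    · exact hfoot.ge
    · have := mul_pos hb (pow_pos (factor_pos hjm) j)
      rw [factor_pow_mul_apex]
      simpa [hf, ← Complex.ofReal_pow] using this.le

theorem smul_triangle_of_not_lt {i : Fin m} (h : ¬(i : ℕ) + 1 < m) :
    pythagorasFactor hjm • triangle hjm i =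
      convexHull ℝ {0, -1, (pythagorasFactor hjm : ℂ) ^ m * apex hjm} := by
  have hm : m = i + 1 := by omega
  have hleg := congrArg Complex.ofReal (factor_pow_mul_shortLeg hjm)
  push_cast at hleg
  rw [smul_triangle, ← mul_assoc, ← mul_assoc, ← pow_succ', ← hm, hleg]

theorem shortLeg_mul_apex_mem :
    (shortLeg hjm : ℂ) * apex hjm ∈
      convexHull ℝ {0, -1, (pythagorasFactor hjm : ℂ) ^ m * apex hjm} := by
  have hfoot : (shortLeg hjm : ℂ) * apex hjm =
      (shortLeg hjm ^ 2) • ((pythagorasFactor hjm : ℂ) ^ m * apex hjm) := by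
    have hleg := congrArg Complex.ofReal (factor_pow_mul_shortLeg hjm)
    push_cast at hleg
    rw [Complex.real_smul]
    push_cast
    linear_combination (-shortLeg hjm * apex hjm : ℂ) * hleg
  rw [hfoot]
  exact (convex_convexHull ℝ _).smul_mem_of_zero_mem (subset_convexHull ℝ _ (by simp))
    (subset_convexHull ℝ _ (by simp))
    ⟨sq_nonneg _, pow_le_one₀ (shortLeg_pos hjm).le (shortLeg_lt_one hjm).le⟩

theorem support_phiTile_subset : (pythagoras hjm).support (phiTile hjm) ⊆
    convexHull ℝ {0, -1, (pythagorasFactor hjm : ℂ) ^ m * apex hjm} := by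
  rw [support_phiTile]
  refine convexHull_min ?_ (convex_convexHull ℝ _)
  rintro z (rfl | rfl | rfl)
  · exact subset_convexHull ℝ _ (by simp)
  · exact shortLeg_mul_apex_mem hjm
  · exact subset_convexHull ℝ _ (by simp)

theorem support_psiTile_subset : (pythagoras hjm).support (psiTile hjm) ⊆
    convexHull ℝ {0, -1, (pythagorasFactor hjm : ℂ) ^ m * apex hjm} := by
  rw [support_psiTile]
  refine convexHull_min ?_ (convex_convexHull ℝ _)
  rintro z (rfl | rfl | rfl)
  · exact subset_convexHull ℝ _ (by simp)
  · exact shortLeg_mul_apex_mem hjm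
  · exact subset_convexHull ℝ _ (by simp)

theorem pythagoras_support_subset {i : Fin m} {T : Tile m} (hT : T ∈ (pythagoras hjm).rule i) :
    (pythagoras hjm).support T ⊆ pythagorasFactor hjm • triangle hjm i := by
  by_cases h : (i : ℕ) + 1 < m
  · rw [pythagoras_rule_of_lt hjm h, mem_singleton_iff] at hT
    rw [hT, support_pythagoras, smul_triangle]
    simp [pow_succ', mul_assoc]
  · rw [pythagoras_rule_of_not_lt hjm h] at hT
    rw [smul_triangle_of_not_lt hjm h]
    obtain rfl | rfl := hT
    · exact support_phiTile_subset hjm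
    · exact support_psiTile_subset hjm

theorem pythagoras_isPacking : (pythagoras hjm).IsPacking where
  factor_pos := factor_pos hjm
  convex := convex_triangle hjm
  compact := isCompact_triangle hjm
  interior_nonempty := interior_triangle_nonempty hjm
  rule_finite i := by
    by_cases h : (i : ℕ) + 1 < m
    · rw [pythagoras_rule_of_lt hjm h]
      exact finite_singleton _
    · rw [pythagoras_rule_of_not_lt hjm h]
      exact toFinite _
  rule_packs i := by
    by_cases h : (i : ℕ) + 1 < m
    · rw [pythagoras_rule_of_lt hjm h]
      exact packs_singleton _
    · rw [pythagoras_rule_of_not_lt hjm h]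
      exact pairwise_pair.2 fun _ => ⟨disjoint_interior_phiTile_psiTile hjm,
        (disjoint_interior_phiTile_psiTile hjm).symm⟩
  rule_subset _ _ := pythagoras_support_subset hjm

end Pythagoras

/-! ### The angle is not a rational multiple of `π` -/

theorem exists_pow_eq_one_of_isIntegral_half_add_inv {ζ : ℂ} {n : ℕ} (hn : 0 < n)
    (hζ : ζ ^ n = 1) (hint : IsIntegral ℤ ((ζ + ζ⁻¹) / 2)) (h0 : (ζ + ζ⁻¹) / 2 ≠ 0) :
    ∃ k, 0 < k ∧ ((ζ + ζ⁻¹) / 2) ^ k = 1 := by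
  have hζint : IsIntegral ℚ ζ :=
    ⟨Polynomial.X ^ n - 1, Polynomial.monic_X_pow_sub_C 1 hn.ne', by simp [hζ]⟩
  let K := IntermediateField.adjoin ℚ {ζ}
  have : FiniteDimensional ℚ K := IntermediateField.adjoin.finiteDimensional hζint
  have : NumberField K := ⟨⟩
  let z : K := IntermediateField.AdjoinSimple.gen ℚ ζ
  let c : K := (z + z⁻¹) / 2
  have hc : algebraMap K ℂ c = (ζ + ζ⁻¹) / 2 := by
    simp only [c, map_div₀, map_add, map_inv₀, map_ofNat]
    rfl
  have hz : z ^ n = 1 := (algebraMap K ℂ).injective (by simpa [z] using hζ)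
  have hcint : IsIntegral ℤ c := by
    rwa [← isIntegral_algebraMap_iff (B := ℂ) (algebraMap K ℂ).injective, hc]
  have hc0 : c ≠ 0 := fun h => h0 (by rw [← hc, h, map_zero])
  -- Every conjugate of `c` is again a mean `(ω + ω⁻¹) / 2` over a root of unity `ω`.
  have hconj (φ : K →+* ℂ) : ‖φ c‖ ≤ 1 := by
    have hω : ‖φ z‖ = 1 :=
      Complex.norm_eq_one_of_pow_eq_one (by rw [← map_pow, hz, map_one]) hn.ne'
    have hsum : ‖φ z + (φ z)⁻¹‖ ≤ 2 := by
      refine (norm_add_le _ _).trans ?_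
      rw [norm_inv, hω]
      norm_num
    simp only [c, map_div₀, map_add, map_inv₀, map_ofNat, norm_div]
    rw [div_le_one (by simp)]
    simpa using hsum
  obtain ⟨k, hk, hck⟩ :=
    NumberField.Embeddings.pow_eq_one_of_norm_le_one K ℂ hc0 hcint hconj
  exact ⟨k, hk, by rw [← hc, ← map_pow, hck, map_one]⟩

section Irrational

variable {m j : ℕ} (hj : 1 ≤ j) (hjm : j < m)

include hj

theorem isIntegral_inv_factor : IsIntegral ℤ ((pythagorasFactor hjm : ℂ)⁻¹) := by
  refine ⟨Polynomial.X ^ (2 * m) + (Polynomial.X ^ (2 * (m - j)) - 1), ?_, ?_⟩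
  · refine Polynomial.monic_X_pow_add ((Polynomial.degree_sub_le _ _).trans_lt ?_)
    rw [Polynomial.degree_X_pow, Polynomial.degree_one, max_lt_iff]
    norm_cast
    omega
  · have hx : (pythagorasFactor hjm : ℂ) ≠ 0 := by exact_mod_cast (factor_pos hjm).ne'
    have hspec : (pythagorasFactor hjm : ℂ) ^ (2 * m) = pythagorasFactor hjm ^ (2 * j) + 1 := by
      exact_mod_cast factor_pow_two_mul hjm
    have hsplit : 2 * m = 2 * j + 2 * (m - j) := by omega
    simp only [Polynomial.eval₂_add, Polynomial.eval₂_sub, Polynomial.eval₂_X_pow,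
      Polynomial.eval₂_one, inv_pow]
    rw [hsplit, pow_add] at hspec ⊢
    field_simp
    linear_combination -hspec

theorem isIntegral_shortLeg : IsIntegral ℤ (shortLeg hjm : ℂ) := by
  simpa [shortLeg] using (isIntegral_inv_factor hj hjm).pow m

theorem exp_theta_pow_ne_one {n : ℕ} (hn : 0 < n) :
    Complex.exp (theta hjm * Complex.I) ^ n ≠ 1 := by
  intro h
  have hcos : (Complex.exp (theta hjm * Complex.I) +
      (Complex.exp (theta hjm * Complex.I))⁻¹) / 2 = shortLeg hjm := by
    rw [← Complex.exp_neg, ← neg_mul, ← Complex.ofReal_neg, exp_neg_theta, exp_theta]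
    ring
  have ha := shortLeg_pos hjm
  obtain ⟨k, hk, hck⟩ := exists_pow_eq_one_of_isIntegral_half_add_inv hn h
    (hcos ▸ isIntegral_shortLeg hj hjm) (by rw [hcos]; exact_mod_cast ha.ne')
  rw [hcos] at hck
  exact (pow_lt_one₀ ha.le (shortLeg_lt_one hjm) hk.ne').ne (by exact_mod_cast hck)

end Irrational

/-! ### The switched rectangle -/

section Supertiles

open Substitution

variable {m j : ℕ} (hjm : j < m)

theorem supertile_pythagoras_of_lt {i : Fin m} {k : ℕ} (h : (i : ℕ) + k < m) :
    (pythagoras hjm).supertile k i = {(⟨i + k, h⟩, 1)} := by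
  induction k with
  | zero => rfl
  | succ k ih =>
    calc (pythagoras hjm).supertile (k + 1) i
      _ = (pythagoras hjm).apply ((pythagoras hjm).supertile k i) := by
        rw [add_comm, supertile_add, Function.iterate_one]
      _ = _ := by
        rw [ih (by omega), apply_singleton, pythagoras_rule_of_lt hjm h, image_singleton,
          dilate_one_right, Tile.move_one]
        rfl

theorem supertile_pythagoras_of_eq {i : Fin m} {k : ℕ} (h : (i : ℕ) + k = m) :
    (pythagoras hjm).supertile k i = {phiTile hjm, psiTile hjm} := by
  obtain ⟨k, rfl⟩ : ∃ l, k = l + 1 := ⟨k - 1, by omega⟩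
  rw [add_comm k 1, supertile_add, supertile_pythagoras_of_lt hjm (by omega),
    Function.iterate_one, apply_singleton, pythagoras_rule_of_not_lt hjm (by simp; omega),
    dilate_one_right]
  simp [Tile.move_one]

theorem iterate_phiTile {k : ℕ} (h : k < m) :
    (pythagoras hjm).apply^[k] {phiTile hjm} = {(⟨k, h⟩, mirror (-theta hjm) 0)} := by
  rw [iterate_apply_singleton, phiTile, supertile_pythagoras_of_lt hjm (by simpa using h),
    image_singleton, dilate_mirror]
  simp [Tile.move]

/-- The tile `H P C` of `oldPair`, below the diagonal of the rectangle. -/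
def oldLower : Tile m := (⟨j, hjm⟩, rot (Real.pi / 2) (apex hjm))

/-- The tile `C Q H` of `oldPair`, above the diagonal of the rectangle. -/
def oldUpper : Tile m := (⟨j, hjm⟩, rot (-(Real.pi / 2)) (-(pythagorasFactor hjm : ℂ) ^ m))

/-- The tile `Q C P` of `newPair`, below the other diagonal of the rectangle. -/
def newLower : Tile m :=
  (⟨j, hjm⟩, mirror (Real.pi / 2)
    (-(pythagorasFactor hjm : ℂ) ^ m + (longLeg hjm : ℂ) * Complex.I))

/-- The tile `P H Q` of `newPair`, above the other diagonal of the rectangle. -/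
def newUpper : Tile m := (⟨j, hjm⟩, mirror (-(Real.pi / 2)) (-(shortLeg hjm : ℂ)))

theorem oldPair_eq : oldPair hjm = {oldLower hjm, oldUpper hjm} := rfl

theorem newPair_eq : newPair hjm = {newLower hjm, newUpper hjm} := rfl

/-- The tiles of `σ ^ (2 * m) (T_1)` that come from `psiTile` and do not belong to `oldPair`. -/
def cornerPatch : Set (Tile m) :=
  Tile.move (dilate (pythagorasFactor hjm ^ m) (psiTile hjm).2) ''
    (pythagoras hjm).apply^[j] {psiTile hjm}

theorem supertile_pythagoras_self : (pythagoras hjm).supertile m ⟨j, hjm⟩ =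
    {(⟨j, hjm⟩, mirror (-theta hjm) 0)} ∪ (pythagoras hjm).apply^[j] {psiTile hjm} := by
  calc (pythagoras hjm).supertile m ⟨j, hjm⟩
    _ = (pythagoras hjm).supertile (j + (m - j)) ⟨j, hjm⟩ := by rw [Nat.add_sub_cancel' hjm.le]
    _ = (pythagoras hjm).apply^[j] ({phiTile hjm} ∪ {psiTile hjm}) := by
      rw [supertile_add, supertile_pythagoras_of_eq hjm (i := ⟨j, hjm⟩)
        (Nat.add_sub_cancel' hjm.le), insert_eq]
    _ = _ := by rw [iterate_apply_union, iterate_phiTile hjm hjm]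

theorem iterate_m_phiTile :
    (pythagoras hjm).apply^[m] {phiTile hjm} = {(⟨0, by omega⟩, 1), oldLower hjm} := by
  rw [iterate_apply_singleton, phiTile, supertile_pythagoras_of_eq hjm (by simp), image_pair,
    dilate_mirror]
  congr 1
  · simp [Tile.move, phiTile, mirror_mul_mirror, rot_zero_zero]
  · simp only [Tile.move, psiTile, oldLower, mirror_mul_mirror, exp_neg_theta, apex]
    congr 3
    · ring
    · simp only [map_neg, map_one, mul_zero, add_zero]
      ring

theorem move_psiTile_mirror :
    Tile.move (dilate (pythagorasFactor hjm ^ m) (psiTile hjm).2)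
      (⟨j, hjm⟩, mirror (-theta hjm) 0) = oldUpper hjm := by
  simp only [Tile.move, psiTile, oldUpper, dilate_mirror, mirror_mul_mirror]
  congr 2
  · ring
  · simp

theorem iterate_m_psiTile :
    (pythagoras hjm).apply^[m] {psiTile hjm} = {oldUpper hjm} ∪ cornerPatch hjm := by
  rw [iterate_apply_singleton, cornerPatch, show (psiTile hjm).1 = ⟨j, hjm⟩ from rfl,
    supertile_pythagoras_self, image_union, image_singleton, ← move_psiTile_mirror]
  rfl

theorem supertile_two_mul : (pythagoras hjm).supertile (2 * m) ⟨0, by omega⟩ =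
    {(⟨0, by omega⟩, 1), oldLower hjm} ∪ ({oldUpper hjm} ∪ cornerPatch hjm) := by
  rw [two_mul, supertile_add, supertile_pythagoras_of_eq hjm (by simp), insert_eq,
    iterate_apply_union, iterate_m_phiTile, iterate_m_psiTile]

theorem oldPair_subset :
    oldPair hjm ⊆ (pythagoras hjm).supertile (2 * m) ⟨0, by omega⟩ := by
  rw [supertile_two_mul, oldPair_eq]
  rintro _ (rfl | rfl) <;> simp

theorem disjoint_cornerPatch_oldPair : Disjoint (cornerPatch hjm) (oldPair hjm) := by
  have hs := pythagoras_isPacking hjm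
  rw [Set.disjoint_right, oldPair_eq]
  rintro _ (rfl | rfl) hmem
  · have h := hs.disjoint_iterate_singleton m (disjoint_interior_phiTile_psiTile hjm)
    rw [iterate_m_phiTile, iterate_m_psiTile] at h
    exact Set.disjoint_left.1 h (Or.inr rfl) (Or.inr hmem)
  · have h := hs.disjoint_iterate_singleton j (disjoint_interior_phiTile_psiTile hjm)
    rw [iterate_phiTile hjm hjm, ← disjoint_image_iff (Tile.move_injective
      (dilate (pythagorasFactor hjm ^ m) (psiTile hjm).2)), image_singleton,
      move_psiTile_mirror] at h
    exact Set.disjoint_left.1 h rfl hmem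

/-- The image `ρ(T_1)` of the first prototile under the Pythia substitution `ρ`. -/
def pythiaPatch : Set (Tile m) :=
  ((pythagoras hjm).supertile (2 * m) ⟨0, by omega⟩ \ oldPair hjm) ∪ newPair hjm

theorem pythia_rule (i : Fin m) :
    (pythia hjm).rule i = (pythagoras hjm).apply^[i] (pythiaPatch hjm) := rfl

theorem cornerPatch_subset_pythiaPatch : cornerPatch hjm ⊆ pythiaPatch hjm := fun _ hT =>
  Or.inl ⟨by rw [supertile_two_mul]; exact Or.inr (Or.inr hT),
    Set.disjoint_left.1 (disjoint_cornerPatch_oldPair hjm) hT⟩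

theorem newLower_mem_pythiaPatch : newLower hjm ∈ pythiaPatch hjm := Or.inr (Or.inl rfl)

theorem dir_oldLower : (oldLower hjm).dir = Complex.I := by
  rw [Tile.dir, oldLower, linear_rot, exp_pi_div_two, mul_one]

theorem dir_oldUpper : (oldUpper hjm).dir = -Complex.I := by
  rw [Tile.dir, oldUpper, linear_rot, exp_neg_pi_div_two, mul_one]

theorem dir_newLower : (newLower hjm).dir = Complex.I := by
  rw [Tile.dir, newLower, linear_mirror, exp_pi_div_two, map_one, mul_one]

theorem dir_newUpper : (newUpper hjm).dir = -Complex.I := by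
  rw [Tile.dir, newUpper, linear_mirror, exp_neg_pi_div_two, map_one, mul_one]

theorem first_mem_pythiaPatch : ((⟨0, by omega⟩, 1) : Tile m) ∈ pythiaPatch hjm := by
  refine Or.inl ⟨by rw [supertile_two_mul]; exact Or.inl (Or.inl rfl), ?_⟩
  rw [oldPair_eq]
  have hdir : Tile.dir ((⟨0, by omega⟩, 1) : Tile m) = 1 := rfl
  rintro (h | h) <;> have h' := congrArg Complex.re (hdir.symm.trans (congrArg Tile.dir h))
  · simp [dir_oldLower] at h'
  · simp [dir_oldUpper] at h'

theorem ne_of_dir_eq_I_of_dir_eq_neg_I {T T' : Tile m} (hT : T.dir = Complex.I)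
    (hT' : T'.dir = -Complex.I) : T ≠ T' := by
  rintro rfl
  exact self_ne_neg.2 Complex.I_ne_zero (hT.symm.trans hT')

theorem oldLower_ne_oldUpper : oldLower hjm ≠ oldUpper hjm :=
  ne_of_dir_eq_I_of_dir_eq_neg_I (dir_oldLower hjm) (dir_oldUpper hjm)

theorem newLower_ne_newUpper : newLower hjm ≠ newUpper hjm :=
  ne_of_dir_eq_I_of_dir_eq_neg_I (dir_newLower hjm) (dir_newUpper hjm)

end Supertiles

/-! ### The Pythia substitution is a packing -/

theorem smul_add_smul_add_smul_mem_convexHull {E : Type*} [AddCommGroup E] [Module ℝ E]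
    {x y z : E} {a b c : ℝ} (ha : 0 ≤ a) (hb : 0 ≤ b) (hc : 0 ≤ c) (h : a + b + c = 1) :
    a • x + b • y + c • z ∈ convexHull ℝ {x, y, z} := by
  have hmem := (convex_convexHull ℝ {x, y, z}).sum_mem (t := Finset.univ)
    (w := ![a, b, c]) (z := ![x, y, z]) (by simp [Fin.forall_fin_succ, ha, hb, hc])
    (by simpa [Fin.sum_univ_three] using h)
    fun i _ => subset_convexHull ℝ _ (by fin_cases i <;> simp)
  simpa [Fin.sum_univ_three] using hmem

section Rectangle

theorem convex_reProdIm {s t : Set ℝ} (hs : Convex ℝ s) (ht : Convex ℝ t) : Convex ℝ (s ×ℂ t) :=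
  (hs.linear_preimage Complex.reLm).inter (ht.linear_preimage Complex.imLm)

variable {x₀ x₁ y₀ y₁ : ℝ}

theorem reProdIm_subset_convexHull_union (hx : x₀ ≤ x₁) (hy : y₀ ≤ y₁) :
    Icc x₀ x₁ ×ℂ Icc y₀ y₁ ⊆
      convexHull ℝ {⟨x₁, y₁⟩, ⟨x₁, y₀⟩, ⟨x₀, y₀⟩} ∪
        convexHull ℝ {⟨x₀, y₀⟩, ⟨x₀, y₁⟩, ⟨x₁, y₁⟩} := by
  rw [← segment_eq_Icc hx, ← segment_eq_Icc hy, segment_eq_image', segment_eq_image']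
  rintro ⟨_, _⟩ ⟨⟨p, ⟨hp₀, hp₁⟩, rfl⟩, q, ⟨hq₀, hq₁⟩, rfl⟩
  obtain hqp | hpq := le_total q p
  · refine Or.inl ?_
    convert smul_add_smul_add_smul_mem_convexHull hq₀ (sub_nonneg.2 hqp) (sub_nonneg.2 hp₁)
      (by ring) using 1
    refine Complex.ext ?_ ?_ <;> simp <;> ring
  · refine Or.inr ?_
    convert smul_add_smul_add_smul_mem_convexHull (sub_nonneg.2 hq₁) (sub_nonneg.2 hpq) hp₀
      (by ring) using 1
    refine Complex.ext ?_ ?_ <;> simp <;> ring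

theorem disjoint_interior_convexHull_antidiagonal (hx : x₀ ≤ x₁) (hy : y₀ < y₁) :
    Disjoint (interior (convexHull ℝ {⟨x₀, y₁⟩, ⟨x₀, y₀⟩, ⟨x₁, y₀⟩}))
      (interior (convexHull ℝ ({⟨x₁, y₀⟩, ⟨x₁, y₁⟩, ⟨x₀, y₁⟩} : Set ℂ))) := by
  have hxy := mul_nonneg (sub_nonneg.2 hx) (sub_nonneg.2 hy.le)
  let f : StrongDual ℝ ℂ := (y₁ - y₀) • Complex.reCLM + (x₁ - x₀) • Complex.imCLM
  have hf (z : ℂ) : f z = (y₁ - y₀) * z.re + (x₁ - x₀) * z.im := rfl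
  have hf0 : f ≠ 0 := fun h => (sub_pos.2 hy).ne' (by simpa [hf] using DFunLike.congr_fun h 1)
  refine disjoint_interior_convexHull_of_le_of_le hf0 (c := x₁ * y₁ - x₀ * y₀) ?_ ?_ <;>
  · rintro z (rfl | rfl | rfl) <;> rw [hf] <;> linarith

end Rectangle

section PythiaPacking

open Substitution
open scoped Pointwise

variable {m j : ℕ} (hjm : j < m)

theorem support_pythagoras_j (g : Motion) : (pythagoras hjm).support (⟨j, hjm⟩, g) =
    convexHull ℝ
      {g 0, g ⟨-longLeg hjm, 0⟩, g ⟨-longLeg hjm, pythagorasFactor hjm ^ m - shortLeg hjm⟩} := by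
  rw [support_pythagoras, ← factor_pow_j_mul_longLeg]
  congr 5
  · simp [Complex.ext_iff, longLeg_eq, ← Complex.ofReal_pow]
  · simp [Complex.ext_iff, longLeg_eq, apex, ← Complex.ofReal_pow]

theorem support_oldLower : (pythagoras hjm).support (oldLower hjm) = convexHull ℝ
    {⟨-shortLeg hjm, longLeg hjm⟩, ⟨-shortLeg hjm, 0⟩, ⟨-pythagorasFactor hjm ^ m, 0⟩} := by
  simp only [oldLower, support_pythagoras_j, rot_apply, exp_pi_div_two]
  congr! 4 <;> simp [Complex.ext_iff, apex]
  ring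

theorem support_oldUpper : (pythagoras hjm).support (oldUpper hjm) = convexHull ℝ
    {⟨-pythagorasFactor hjm ^ m, 0⟩, ⟨-pythagorasFactor hjm ^ m, longLeg hjm⟩,
      ⟨-shortLeg hjm, longLeg hjm⟩} := by
  simp only [oldUpper, support_pythagoras_j, rot_apply, exp_neg_pi_div_two]
  congr! 4 <;> simp [Complex.ext_iff, ← Complex.ofReal_pow]
  ring

theorem support_newLower : (pythagoras hjm).support (newLower hjm) = convexHull ℝ
    {⟨-pythagorasFactor hjm ^ m, longLeg hjm⟩, ⟨-pythagorasFactor hjm ^ m, 0⟩,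
      ⟨-shortLeg hjm, 0⟩} := by
  simp only [newLower, support_pythagoras_j, mirror_apply, exp_pi_div_two]
  congr! 4 <;> simp [Complex.ext_iff, ← Complex.ofReal_pow]
  ring

theorem support_newUpper : (pythagoras hjm).support (newUpper hjm) = convexHull ℝ
    {⟨-shortLeg hjm, 0⟩, ⟨-shortLeg hjm, longLeg hjm⟩,
      ⟨-pythagorasFactor hjm ^ m, longLeg hjm⟩} := by
  simp only [newUpper, support_pythagoras_j, mirror_apply, exp_neg_pi_div_two]
  congr! 4 <;> simp [Complex.ext_iff]
  ring

theorem shortLeg_lt_factor_pow : shortLeg hjm < pythagorasFactor hjm ^ m :=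
  (shortLeg_lt_one hjm).trans (one_lt_pow₀ (one_lt_factor hjm) (by omega))

/-- The rectangle `C P H Q` in which the diagonal is switched. -/
def switchRectangle : Set ℂ :=
  Icc (-pythagorasFactor hjm ^ m) (-shortLeg hjm) ×ℂ Icc 0 (longLeg hjm)

theorem support_newPair_subset {T : Tile m} (hT : T ∈ newPair hjm) :
    (pythagoras hjm).support T ⊆ switchRectangle hjm := by
  have hb := longLeg_pos hjm
  have ha := shortLeg_lt_factor_pow hjm
  have hconv : Convex ℝ (switchRectangle hjm) := convex_reProdIm (convex_Icc _ _) (convex_Icc _ _)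
  rw [newPair_eq] at hT
  obtain rfl | rfl := hT
  · rw [support_newLower]
    refine convexHull_min ?_ hconv
    rintro z (rfl | rfl | rfl) <;> simp [switchRectangle, Complex.mem_reProdIm, hb.le, ha.le]
  · rw [support_newUpper]
    refine convexHull_min ?_ hconv
    rintro z (rfl | rfl | rfl) <;> simp [switchRectangle, Complex.mem_reProdIm, hb.le, ha.le]

theorem exists_mem_oldPair_mem_support {z : ℂ} (hz : z ∈ switchRectangle hjm) :
    ∃ T ∈ oldPair hjm, z ∈ (pythagoras hjm).support T := by
  rw [oldPair_eq]
  obtain h | h := reProdIm_subset_convexHull_union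
    (neg_le_neg (shortLeg_lt_factor_pow hjm).le) (longLeg_pos hjm).le hz
  · exact ⟨_, Or.inl rfl, support_oldLower hjm ▸ h⟩
  · exact ⟨_, Or.inr rfl, support_oldUpper hjm ▸ h⟩

theorem packs_newPair : (pythagoras hjm).Packs (newPair hjm) := by
  have h : Disjoint (interior ((pythagoras hjm).support (newLower hjm)))
      (interior ((pythagoras hjm).support (newUpper hjm))) := by
    rw [support_newLower, support_newUpper]
    exact disjoint_interior_convexHull_antidiagonal
      (neg_le_neg (shortLeg_lt_factor_pow hjm).le) (longLeg_pos hjm)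
  exact pairwise_pair.2 fun _ => ⟨h, h.symm⟩

theorem disjoint_interior_of_mem_newPair {T T' : Tile m}
    (hT : T ∈ (pythagoras hjm).supertile (2 * m) ⟨0, by omega⟩ \ oldPair hjm)
    (hT' : T' ∈ newPair hjm) :
    Disjoint (interior ((pythagoras hjm).support T))
      (interior ((pythagoras hjm).support T')) := by
  have hs := pythagoras_isPacking hjm
  rw [Set.disjoint_left]
  intro z hz hz'
  obtain ⟨U, hU, hzU⟩ := exists_mem_oldPair_mem_support hjm
    (support_newPair_subset hjm hT' (interior_subset hz'))
  obtain ⟨w, hw, hwU⟩ := hs.inter_interior_support_nonempty isOpen_interior ⟨z, hzU, hz⟩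
  exact Set.disjoint_left.1 (hs.packs_supertile _ _ hT.1 (oldPair_subset hjm hU)
    fun he => hT.2 (he ▸ hU)) hw hwU

theorem packs_pythiaPatch : (pythagoras hjm).Packs (pythiaPatch hjm) := by
  rintro T (hT | hT) T' (hT' | hT') hne
  · exact (pythagoras_isPacking hjm).packs_supertile _ _ hT.1 hT'.1 hne
  · exact disjoint_interior_of_mem_newPair hjm hT hT'
  · exact (disjoint_interior_of_mem_newPair hjm hT' hT).symm
  · exact packs_newPair hjm hT hT' hne

theorem finite_pythiaPatch : (pythiaPatch hjm).Finite :=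
  ((pythagoras_isPacking hjm).finite_supertile _ _).sdiff.union (toFinite {_, _})

theorem support_pythiaPatch_subset {T : Tile m} (hT : T ∈ pythiaPatch hjm) :
    (pythagoras hjm).support T ⊆
      pythagorasFactor hjm ^ (2 * m) • triangle hjm ⟨0, by omega⟩ := by
  have hsub {U : Tile m} (hU : U ∈ (pythagoras hjm).supertile (2 * m) ⟨0, by omega⟩) :
      (pythagoras hjm).support U ⊆ pythagorasFactor hjm ^ (2 * m) • triangle hjm ⟨0, by omega⟩ := by
    simpa [support] using! (pythagoras_isPacking hjm).support_subset_of_mem_iterate_singleton hU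
  obtain hT | hT := hT
  · exact hsub hT.1
  · intro z hz
    obtain ⟨U, hU, hzU⟩ :=
      exists_mem_oldPair_mem_support hjm (support_newPair_subset hjm hT hz)
    exact hsub (oldPair_subset hjm hU) hzU

theorem pythia_isPacking : (pythia hjm).IsPacking where
  factor_pos := pow_pos (factor_pos hjm) _
  convex := (pythagoras_isPacking hjm).convex
  compact := (pythagoras_isPacking hjm).compact
  interior_nonempty := interior_triangle_nonempty hjm
  rule_finite i := (pythagoras_isPacking hjm).finite_iterate (finite_pythiaPatch hjm) i
  rule_packs i := (pythagoras_isPacking hjm).packs_iterate (packs_pythiaPatch hjm) i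
  rule_subset i T hT := by
    rw [pythia_rule, iterate_apply_eq_biUnion] at hT
    obtain ⟨U, hU, hTU⟩ := mem_iUnion₂.1 hT
    calc (pythagoras hjm).support T
      _ ⊆ pythagorasFactor hjm ^ (i : ℕ) • (pythagoras hjm).support U :=
        (pythagoras_isPacking hjm).support_subset_of_mem_iterate_singleton hTU
      _ ⊆ pythagorasFactor hjm ^ (i : ℕ) •
          pythagorasFactor hjm ^ (2 * m) • triangle hjm ⟨0, by omega⟩ :=
        smul_set_mono (support_pythiaPatch_subset hjm hU)
      _ = pythagorasFactor hjm ^ (2 * m) • triangle hjm i := by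
        rw [smul_comm, triangle_eq_smul, triangle_eq_smul, pow_zero, one_smul]

/-- The areas of the prototiles, relative to the first one. -/
def weight (i : Fin m) : ℝ := (pythagorasFactor hjm ^ 2) ^ (i : ℕ)

theorem phiTile_ne_psiTile : phiTile hjm ≠ psiTile hjm := by
  intro h
  have hdisj := disjoint_interior_phiTile_psiTile hjm
  rw [h, disjoint_self] at hdisj
  exact ((pythagoras_isPacking hjm).support_interior_nonempty _).ne_empty hdisj

theorem pythagoras_isPerronWeight :
    (pythagoras hjm).IsPerronWeight (pythagorasFactor hjm ^ 2) (weight hjm) where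
  pos _ := pow_pos (pow_pos (factor_pos hjm) _) _
  finsum_rule i := by
    by_cases h : (i : ℕ) + 1 < m
    · rw [pythagoras_rule_of_lt hjm h, finsum_mem_singleton, weight, weight, pow_succ']
    · have hi : (i : ℕ) + 1 = m := by omega
      calc ∑ᶠ T ∈ (pythagoras hjm).rule i, weight hjm T.1
        _ = weight hjm ⟨0, by omega⟩ + weight hjm ⟨j, hjm⟩ := by
          rw [pythagoras_rule_of_not_lt hjm h, finsum_mem_pair (phiTile_ne_psiTile hjm)]
          rfl
        _ = pythagorasFactor hjm ^ (2 * j) + 1 := by simp [weight, ← pow_mul, add_comm]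
        _ = pythagorasFactor hjm ^ (2 * m) := (factor_pow_two_mul hjm).symm
        _ = pythagorasFactor hjm ^ 2 * weight hjm i := by
          rw [weight, ← pow_succ', hi, pow_mul]

theorem finsum_weight_pythiaPatch :
    ∑ᶠ T ∈ pythiaPatch hjm, weight hjm T.1 = (pythagorasFactor hjm ^ 2) ^ (2 * m) := by
  have hs := pythagoras_isPacking hjm
  have hfin := hs.finite_supertile (2 * m) ⟨0, by omega⟩
  have hdisj : Disjoint ((pythagoras hjm).supertile (2 * m) ⟨0, by omega⟩ \ oldPair hjm)
      (newPair hjm) := by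
    rw [Set.disjoint_left]
    intro T hT hT'
    obtain ⟨z, hz⟩ := hs.support_interior_nonempty T
    exact Set.disjoint_left.1 (disjoint_interior_of_mem_newPair hjm hT hT') hz hz
  have hpair : ∑ᶠ T ∈ newPair hjm, weight hjm T.1 = ∑ᶠ T ∈ oldPair hjm, weight hjm T.1 := by
    rw [newPair_eq, oldPair_eq, finsum_mem_pair (newLower_ne_newUpper hjm),
      finsum_mem_pair (oldLower_ne_oldUpper hjm)]
    rfl
  calc ∑ᶠ T ∈ pythiaPatch hjm, weight hjm T.1
    _ = ∑ᶠ T ∈ (pythagoras hjm).supertile (2 * m) ⟨0, by omega⟩, weight hjm T.1 := by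
      rw [pythiaPatch, finsum_mem_union hdisj hfin.sdiff (toFinite {_, _}), hpair, add_comm,
        finsum_mem_add_sdiff (oldPair_subset hjm) hfin]
    _ = (pythagorasFactor hjm ^ 2) ^ (2 * m) := by
      rw [(pythagoras_isPerronWeight hjm).finsum_supertile hs]
      simp [weight]

theorem pythia_isPerronWeight :
    (pythia hjm).IsPerronWeight ((pythagorasFactor hjm ^ 2) ^ (2 * m)) (weight hjm) where
  pos := (pythagoras_isPerronWeight hjm).pos
  finsum_rule i := by
    rw [pythia_rule, (pythagoras_isPerronWeight hjm).finsum_iterate (pythagoras_isPacking hjm)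
      (packs_pythiaPatch hjm) (finite_pythiaPatch hjm), finsum_weight_pythiaPatch, mul_comm, weight]

end PythiaPacking

/-! ### Primitivity and interference -/

namespace Substitution

variable {n : ℕ} {s : Substitution n}

theorem matrix_pos (hfin : ∀ i, (s.rule i).Finite) {i k : Fin n} {g : Motion}
    (hg : (k, g) ∈ s.rule i) : 0 < s.matrix i k := by
  rw [matrix, Matrix.of_apply, Nat.cast_pos]
  exact (ncard_pos ((hfin i).preimage (Prod.mk_right_injective k).injOn)).2 ⟨g, hg⟩

theorem exists_mem_rule_of_matrix_ne_zero {i k : Fin n} (h : s.matrix i k ≠ 0) :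
    ∃ g, (k, g) ∈ s.rule i := by
  rw [matrix, Matrix.of_apply, Nat.cast_ne_zero] at h
  exact nonempty_of_ncard_ne_zero h

theorem matrix_nonneg (i k : Fin n) : 0 ≤ s.matrix i k := Nat.cast_nonneg _

theorem matrix_pow_succ_pos {r : ℕ} {i l k : Fin n} (h : 0 < (s.matrix ^ r) i l)
    (h' : 0 < s.matrix l k) : 0 < (s.matrix ^ (r + 1)) i k := by
  rw [pow_succ, Matrix.mul_apply]
  exact Finset.sum_pos' (fun l _ =>
    mul_nonneg (Matrix.pow_apply_nonneg matrix_nonneg r i l) (matrix_nonneg l k))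
    ⟨l, Finset.mem_univ l, mul_pos h h'⟩

theorem exists_mem_supertile_of_matrix_pow_ne_zero {r : ℕ} {i k : Fin n}
    (h : (s.matrix ^ r) i k ≠ 0) : ∃ g, (k, g) ∈ s.supertile r i := by
  induction r generalizing k with
  | zero =>
    obtain rfl : i = k := by
      by_contra hne
      exact h (Matrix.one_apply_ne hne)
    exact ⟨1, rfl⟩
  | succ r ih =>
    rw [pow_succ, Matrix.mul_apply] at h
    obtain ⟨l, -, hl⟩ := Finset.exists_ne_zero_of_sum_ne_zero h
    obtain ⟨g, hg⟩ := ih (left_ne_zero_of_mul hl)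
    obtain ⟨g', hg'⟩ := exists_mem_rule_of_matrix_ne_zero (right_ne_zero_of_mul hl)
    rw [← supertile_one] at hg'
    rw [add_comm]
    exact ⟨_, s.move_mem_supertile_add hg hg'⟩

end Substitution

section Pythia

open Substitution

variable {m j : ℕ} (hjm : j < m)

theorem self_mem_rule (i : Fin m) : (i, 1) ∈ (pythia hjm).rule i := by
  have h := (pythagoras hjm).move_mem_iterate_apply (k := i) (T' := (i, 1))
    (first_mem_pythiaPatch hjm) (by rw [supertile_pythagoras_of_lt hjm (by simp)]; simp)
  rwa [dilate_one_right, Tile.move_one] at h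

theorem exists_mem_supertile_add_mod (i : Fin m) :
    ∃ g : Motion, ((⟨(i + j) % m, Nat.mod_lt _ (by omega)⟩, g) : Tile m) ∈
      (pythagoras hjm).supertile i ⟨j, hjm⟩ := by
  by_cases h : (i : ℕ) + j < m
  · refine ⟨1, ?_⟩
    rw [supertile_pythagoras_of_lt hjm (by simpa only [add_comm] using h)]
    exact Prod.ext (Fin.ext ((Nat.mod_eq_of_lt h).trans (add_comm _ _))) rfl
  · refine ⟨mirror (-theta hjm) 0, ?_⟩
    have hmod : ((i : ℕ) + j) % m = i + j - m := by
      rw [Nat.mod_eq_sub_mod (by omega), Nat.mod_eq_of_lt (by omega)]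
    have hadd := (pythagoras hjm).supertile_add (i + j - m) (m - j) ⟨j, hjm⟩
    rw [show (i : ℕ) + j - m + (m - j) = i by omega,
      supertile_pythagoras_of_eq hjm (i := ⟨j, hjm⟩) (Nat.add_sub_cancel' hjm.le), insert_eq,
      iterate_apply_union, iterate_phiTile hjm (by omega)] at hadd
    simp only [hmod, hadd]
    exact Or.inl rfl

theorem matrix_pos_self (i : Fin m) : 0 < (pythia hjm).matrix i i :=
  matrix_pos (pythia_isPacking hjm).rule_finite (self_mem_rule hjm i)

theorem matrix_pos_add_mod (i : Fin m) :
    0 < (pythia hjm).matrix i ⟨(i + j) % m, Nat.mod_lt _ (by omega)⟩ := by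
  obtain ⟨g, hg⟩ := exists_mem_supertile_add_mod hjm i
  exact matrix_pos (pythia_isPacking hjm).rule_finite
    ((pythagoras hjm).move_mem_iterate_apply (newLower_mem_pythiaPatch hjm) hg)

theorem matrix_pow_pos_add_mul_mod (k r : ℕ) (hr : r ≤ k) (i : Fin m) :
    0 < ((pythia hjm).matrix ^ k) i ⟨(i + r * j) % m, Nat.mod_lt _ (by omega)⟩ := by
  induction k generalizing r with
  | zero =>
    obtain rfl : r = 0 := by omega
    simp [Nat.mod_eq_of_lt i.2]
  | succ k ih =>
    obtain hr' | rfl : r ≤ k ∨ r = k + 1 := by omega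
    · exact matrix_pow_succ_pos (ih r hr') (matrix_pos_self hjm _)
    · have h := matrix_pow_succ_pos (ih k le_rfl) (matrix_pos_add_mod hjm _)
      simp only [Nat.mod_add_mod] at h
      rwa [show (i : ℕ) + (k + 1) * j = i + k * j + j by ring]

theorem pythia_isPrimitive (hmj : Nat.Coprime m j) : (pythia hjm).matrix.IsPrimitive where
  nonneg := matrix_nonneg
  exists_pos_pow := by
    refine ⟨m, by omega, fun i k => ?_⟩
    have hinj : Function.Injective fun r : Fin m =>
        (⟨(i + r * j) % m, Nat.mod_lt _ (by omega)⟩ : Fin m) := by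
      intro r r' h
      have hmul : (i + r * j : ℕ) ≡ i + r' * j [MOD m] := congrArg Fin.val h
      have hmod := Nat.ModEq.cancel_right_of_coprime hmj (Nat.ModEq.add_left_cancel' _ hmul)
      exact Fin.ext (Nat.ModEq.eq_of_lt_of_lt hmod r.2 r'.2)
    obtain ⟨r, rfl⟩ := Finite.surjective_of_injective hinj k
    exact matrix_pow_pos_add_mul_mod hjm m r r.2.le i

theorem exists_mem_rule_linear_eq_conj (h : m - j < m) : ∃ g : Motion,
    (⟨j, hjm⟩, g) ∈ (pythia hjm).rule ⟨m - j, h⟩ ∧ ∀ z, g.linearIsometryEquiv z =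
      (Complex.exp (theta hjm * Complex.I))⁻¹ * (starRingEnd ℂ) z := by
  have hmem : ((⟨j, hjm⟩, mirror (-theta hjm) 0) : Tile m) ∈
      (pythagoras hjm).supertile m ⟨j, hjm⟩ := by
    rw [supertile_pythagoras_self]
    exact Or.inl rfl
  have hadd := (pythagoras hjm).supertile_add (m - j) j ⟨j, hjm⟩
  rw [Nat.sub_add_cancel hjm.le] at hadd
  have hsub := (pythagoras hjm).iterate_apply_mono (m - j) (cornerPatch_subset_pythiaPatch hjm)
  rw [cornerPatch, iterate_apply_singleton, iterate_apply_move, iterate_apply_move,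
    show (psiTile hjm).1 = ⟨j, hjm⟩ from rfl, ← hadd] at hsub
  refine ⟨_, hsub (mem_image_of_mem _ (mem_image_of_mem _ hmem)), fun z => ?_⟩
  calc (psiTile hjm).2.linearIsometryEquiv ((psiTile hjm).2.linearIsometryEquiv
        ((mirror (-theta hjm) 0).linearIsometryEquiv z))
    _ = (mirror (-theta hjm) 0).linearIsometryEquiv z := by
      rw [psiTile, linear_mirror, linear_mirror, map_mul, Complex.conj_conj, ← mul_assoc,
        Complex.mul_conj', Complex.norm_exp_ofReal_mul_I, Complex.ofReal_one, one_pow, one_mul]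
    _ = (Complex.exp (theta hjm * Complex.I))⁻¹ * (starRingEnd ℂ) z := by
      rw [linear_mirror, Complex.ofReal_neg, neg_mul, Complex.exp_neg]

theorem exists_mem_rule_linear_eq_mul (h : m - j < m) : ∃ g : Motion,
    (⟨0, by omega⟩, g) ∈ (pythia hjm).rule ⟨m - j, h⟩ ∧ ∀ z, g.linearIsometryEquiv z =
      Complex.I * Complex.exp (theta hjm * Complex.I) * z := by
  have hphi : phiTile hjm ∈ (pythagoras hjm).supertile (m - j) ⟨j, hjm⟩ := by
    rw [supertile_pythagoras_of_eq hjm (i := ⟨j, hjm⟩) (Nat.add_sub_cancel' hjm.le)]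
    exact Or.inl rfl
  refine ⟨_, (pythagoras hjm).move_mem_iterate_apply (newLower_mem_pythiaPatch hjm) hphi,
    fun z => ?_⟩
  calc (newLower hjm).2.linearIsometryEquiv
        ((mirror (-theta hjm) 0).linearIsometryEquiv z)
    _ = Complex.I * (starRingEnd ℂ) (Complex.exp ((-theta hjm : ℝ) * Complex.I)) * z := by
      rw [newLower, linear_mirror, linear_mirror, exp_pi_div_two, map_mul, Complex.conj_conj,
        mul_assoc]
    _ = Complex.I * Complex.exp (theta hjm * Complex.I) * z := by
      rw [← Complex.exp_conj]
      simp

theorem exists_interfere (hj : 1 ≤ j) {p : ℕ} (hp : 0 < p) :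
    ∃ i, ∃ T ∈ (pythia hjm).supertile 2 i, ∃ T' ∈ (pythia hjm).supertile 2 i,
      Interfere p T T' := by
  obtain ⟨g, hg, hglin⟩ := exists_mem_rule_linear_eq_conj hjm (by omega)
  obtain ⟨h, hh, hhlin⟩ := exists_mem_rule_linear_eq_mul hjm (by omega)
  have hself := self_mem_rule hjm ⟨j, hjm⟩
  have hnew : newLower hjm ∈ (pythia hjm).rule ⟨0, by omega⟩ := newLower_mem_pythiaPatch hjm
  rw [← supertile_one] at hg hh hself hnew
  set E := Complex.exp (theta hjm * Complex.I)
  have hE0 : E ≠ 0 := Complex.exp_ne_zero _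
  refine ⟨_, _, (pythia hjm).move_mem_supertile_add hg hself, _,
    (pythia hjm).move_mem_supertile_add hh hnew, rfl, -E ^ 2, fun hpow => ?_, fun z => ?_⟩
  · refine exp_theta_pow_ne_one hj hjm (n := 4 * p) (by omega) ?_
    calc E ^ (4 * p) = ((-E ^ 2) ^ p) ^ 2 := by
          rw [pow_right_comm, neg_sq]
          ring
      _ = 1 := by rw [hpow, one_pow]
  · change h.linearIsometryEquiv ((newLower hjm).2.linearIsometryEquiv z) =
      -E ^ 2 * g.linearIsometryEquiv z
    rw [hhlin, hglin, newLower, linear_mirror, exp_pi_div_two]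
    field_simp
    rw [Complex.I_sq, neg_one_mul]

theorem exists_forall_interfere (hj : 1 ≤ j) (hmj : Nat.Coprime m j) {p : ℕ} (hp : 0 < p) :
    ∃ l, ∀ i, ∃ T ∈ (pythia hjm).supertile l i, ∃ T' ∈ (pythia hjm).supertile l i,
      Interfere p T T' := by
  obtain ⟨i₀, T, hT, T', hT', h⟩ := exists_interfere hjm hj hp
  obtain ⟨k, -, hk⟩ := (pythia_isPrimitive hjm hmj).exists_pos_pow
  refine ⟨2 + k, fun i => ?_⟩
  obtain ⟨g, hg⟩ := exists_mem_supertile_of_matrix_pow_ne_zero (hk i i₀).ne'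
  exact ⟨_, (pythia hjm).move_mem_supertile_add hg hT, _,
    (pythia hjm).move_mem_supertile_add hg hT', h.move _⟩

end Pythia

end SubstTiling

end

open SubstTiling in
theorem theorem6p2_general {m j : ℕ} (hj : 1 ≤ j) (hjm : j < m) (hmj : Nat.Coprime m j)
    {𝒯 : Set (Tile m)} (h𝒯 : (pythia hjm).IsSubstitutionTiling 𝒯) :
    (pythia hjm).HasStatisticalCircularSymmetry 𝒯 := by
  refine (pythia_isPacking hjm).hasStatisticalCircularSymmetry (pythia_isPrimitive hjm hmj)
    (fun p hp i => ?_) h𝒯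
  obtain ⟨l, hl⟩ := exists_forall_interfere hjm hj hmj hp
  exact (pythia_isPerronWeight hjm).isLittleO_weylSum_supertile (pythia_isPacking hjm)
    (pow_pos (pow_pos (factor_pos hjm) 2) _) hl i

theorem theorem6p2 (m j : ℕ) (hm : 3 ≤ m) (hj : 1 ≤ j) (hjm : j < m) (hmj : Nat.Coprime m j)
    (𝒯 : Set (SubstTiling.Tile m))
    (h𝒯 : (SubstTiling.pythia hjm).IsSubstitutionTiling 𝒯) :
    (SubstTiling.pythia hjm).HasStatisticalCircularSymmetry 𝒯 :=
  theorem6p2_general hj hjm hmj h𝒯
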